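/- Theorem (Poly-time ERM). For a finite simple undirected connected graph $G=(V,E)$, a set $A\subseteq V$ is m-convex if for all $u,v\in A$ every vertex on an induced path between $u$ and $v$ belongs to $A$; an m-halfspace of $G$ is a set $H\subseteq V$ such that both $H$ and $V\setminus H$ are m-convex. For a sample $X\in\{-1,0,+1\}^V$, where $X(v)=0$ means that $v$ is unlabelled, let $\underline{X}=\{v\in V: X(v)\neq 0\}$, and define the empirical risk of $H\subseteq V$ by $$L(X,H)=\frac{1}{|\underline{X}|}\,\bigl|\{v\in\underline{X}: X(v)\neq \sigma_H(v)\}\bigr|,$$ where $\sigma_H(v)=+1$ if $v\in H$ and $\sigma_H(v)=-1$ if $v\notin H$, and $L(X,H)=0$ if $\underline{X}=\varnothing$. There is a single algorithm (a program of a random access machine with addition, subtraction, comparison with zero and indirect addressing, each operation taking unit time) and a polynomial $T$ such that, for every connected graph $G=(V,E)$ with $V=\{0,\dots,n-1\}$, given by its adjacency matrix, and every sample $X\in\{-1,0,+1\}^V$, which need not be consistent with any m-halfspace, the algorithm halts after at most $T(n)$ steps and outputs an m-halfspace $H$ of $G$ with $L(X,H)\le L(X,H')$ for every m-halfspace $H'$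 of $G$. -/

import Mathlib

/-! ### Monophonic convexity -/

section Monophonic

variable {V : Type*}

/-- `p` is an induced (chordless) path of `G`: a path such that the subgraph of `G` induced by its
vertex set is the path itself. -/
def IsInducedPath (G : SimpleGraph V) {u v : V} (p : G.Walk u v) : Prop :=
  p.IsPath ∧ p.toSubgraph.IsInduced

/-- The monophonic interval `I_m(u, v)`: all vertices that lie on induced `(u, v)`-paths. -/
def monoInterval (G : SimpleGraph V) (u v : V) : Set V :=
  {w | ∃ p : G.Walk u v, IsInducedPath G p ∧ w ∈ p.support}

/-- Monophonically convex vertex sets. -/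
def MConvex (G : SimpleGraph V) (A : Set V) : Prop :=
  ∀ u ∈ A, ∀ v ∈ A, monoInterval G u v ⊆ A

/-- Monophonic halfspaces: `H` and its complement are both monophonically convex. -/
def IsMHalfspace (G : SimpleGraph V) (H : Set V) : Prop :=
  MConvex G H ∧ MConvex G Hᶜ

end Monophonic

/-! ### Empirical risk -/

section Risk

variable {V : Type*} [Fintype V]

open Classical in
/-- The sign vector in `{-1, +1}^V` of a hypothesis `H ⊆ V`. -/
noncomputable def signVector (H : Set V) (v : V) : SignType :=
  if v ∈ H then 1 else -1

/-- The support of a sample `X ∈ {-1, 0, +1}^V`, i.e. the set of labelled vertices. -/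
def sampleSupport (X : V → SignType) : Finset V :=
  {v | X v ≠ 0}

/-- The empirical risk `L(X, H)`: the fraction of labelled vertices on which `X` and the sign
vector of `H` disagree (it is `0` if no vertex is labelled). -/
noncomputable def empiricalRisk (X : V → SignType) (H : Set V) : ℚ :=
  1 / ((sampleSupport X).card : ℚ) *
    ∑ v ∈ sampleSupport X, if X v ≠ signVector H v then 1 else 0

/-- `H` is an m-halfspace of `G` that minimizes the empirical risk on `X` over all
m-halfspaces of `G`. -/
def IsERM (G : SimpleGraph V) (X : V → SignType) (H : Set V) : Prop :=
  IsMHalfspace G H ∧ ∀ H' : Set V, IsMHalfspace G H' → empiricalRisk X H ≤ empiricalRisk X H'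

end Risk

/-! ### Random access machines

The machine model is a random access machine whose memory consists of banks of cells that hold
natural numbers. Programs are structured (`while` programs), banks are named by literals in the
program text, so a program uses only finitely many of them, and cells are addressed by computed
values. The arithmetic consists of addition and truncated subtraction only. Every constant, memory
access, arithmetic operation, assignment and test costs one unit of time. Since there is no
multiplication, a run of `t` steps only produces numbers of `O(t)` more bits than those of the
input, so polynomial time has its usual meaning. -/

namespace RAM

/-- Memory contents: `s k i` is the number in cell `i` of bank `k`. -/
abbrev Memory : Type := ℕ → ℕ → ℕ

/-- Arithmetic expressions. -/
inductive Expr : Type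
  /-- a constant -/
  | const (c : ℕ) : Expr
  /-- the contents of the cell of bank `k` whose address is the value of `i` -/
  | load (k : ℕ) (i : Expr) : Expr
  /-- addition -/
  | add (e₁ e₂ : Expr) : Expr
  /-- truncated subtraction -/
  | sub (e₁ e₂ : Expr) : Expr

/-- The value of an expression. -/
def Expr.eval (s : Memory) : Expr → ℕ
  | .const c => c
  | .load k i => s k (i.eval s)
  | .add e₁ e₂ => e₁.eval s + e₂.eval s
  | .sub e₁ e₂ => e₁.eval s - e₂.eval s

/-- The number of steps taken to evaluate an expression. -/
def Expr.cost : Expr → ℕ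
  | .const _ => 1
  | .load _ i => 1 + i.cost
  | .add e₁ e₂ => 1 + e₁.cost + e₂.cost
  | .sub e₁ e₂ => 1 + e₁.cost + e₂.cost

/-- Programs. Tests are of the form `e ≠ 0`. -/
inductive Program : Type
  /-- do nothing -/
  | skip : Program
  /-- write the value of `e` into the cell of bank `k` whose address is the value of `i` -/
  | store (k : ℕ) (i e : Expr) : Program
  /-- run `p`, then `q` -/
  | seq (p q : Program) : Program
  /-- run `p` if `e ≠ 0`, and `q` otherwise -/
  | cond (e : Expr) (p q : Program) : Program
  /-- run `p` as long as `e ≠ 0` -/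
  | loop (e : Expr) (p : Program) : Program

/-- The memory `s` after the number `x` has been written into cell `i` of bank `k`. -/
def write (s : Memory) (k i x : ℕ) : Memory :=
  Function.update s k (Function.update (s k) i x)

/-- `Runs p s t s'`: started with memory `s`, the program `p` halts after exactly `t` steps, and
then the memory is `s'`. -/
inductive Runs : Program → Memory → ℕ → Memory → Prop
  | skip (s : Memory) : Runs .skip s 1 s
  | store (k : ℕ) (i e : Expr) (s : Memory) :
      Runs (.store k i e) s (1 + i.cost + e.cost) (write s k (i.eval s) (e.eval s))
  | seq {p q : Program} {s s' s'' : Memory} {t t' : ℕ} :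
      Runs p s t s' → Runs q s' t' s'' → Runs (.seq p q) s (t + t') s''
  | cond_true {e : Expr} {p : Program} (q : Program) {s s' : Memory} {t : ℕ} :
      e.eval s ≠ 0 → Runs p s t s' → Runs (.cond e p q) s (1 + e.cost + t) s'
  | cond_false {e : Expr} (p : Program) {q : Program} {s s' : Memory} {t : ℕ} :
      e.eval s = 0 → Runs q s t s' → Runs (.cond e p q) s (1 + e.cost + t) s'
  | loop_stop {e : Expr} (p : Program) {s : Memory} :
      e.eval s = 0 → Runs (.loop e p) s (1 + e.cost) s
  | loop_step {e : Expr} {p : Program} {s s' s'' : Memory} {t t' : ℕ} :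
      e.eval s ≠ 0 → Runs p s t s' → Runs (.loop e p) s' t' s'' →
      Runs (.loop e p) s (1 + e.cost + t + t') s''

/-- The code of a label: `0` for "unlabelled", `1` for `+1`, `2` for `-1`. -/
def labelCode : SignType → ℕ
  | 0 => 0
  | 1 => 1
  | -1 => 2

open Classical in
/-- The input memory for a graph `G` on `Fin n` and a sample `X`: cell `0` of bank `0` holds `n`,
cell `i * n + j` of bank `1` holds the entry `(i, j)` of the adjacency matrix of `G`, cell `i` of
bank `2` holds the code of the label `X i`. All other cells hold `0`. -/
noncomputable def inputMemory {n : ℕ} (G : SimpleGraph (Fin n)) (X : Fin n → SignType) : Memory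
  | 0, 0 => n
  | 1, a => if ∃ i j : Fin n, G.Adj i j ∧ a = (i : ℕ) * n + (j : ℕ) then 1 else 0
  | 2, a => if h : a < n then labelCode (X ⟨a, h⟩) else 0
  | _, _ => 0

open Classical in
/-- The vertex set `H` is the output in memory `s`: the first `n` cells of bank `3` hold the
indicator vector of `H`. -/
def Outputs {n : ℕ} (s : Memory) (H : Set (Fin n)) : Prop :=
  ∀ v : Fin n, s 3 v = if v ∈ H then 1 else 0

end RAM

/-!
A set `H` is a halfspace of a connected graph if and only if both sides of the cut `(H, Hᶜ)` have
clique borders, i.e. the ends of cut edges on either side are pairwise equal or adjacent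
(`isMHalfspace_iff_cliqueBorders`). An induced path that leaves `H` and returns would have a chord
between two border vertices; conversely, two non-adjacent border vertices are joined by an induced
path through the other side.

Fix a cut edge `ab` of a halfspace `H`, with `a ∈ H` and `b ∉ H`. Then `N(a) \ N[b]` is in `H` and
`N(b) \ N[a]` is not, cut edges have no end outside `N[a] ∪ N[b]`, and two non-adjacent common
neighbours of `a` and `b` are on different sides. The remaining conditions couple the common
neighbours `Δ` with the private neighbours `c` of `a` (and of `b`): either `c` is not on the border
and `N(c) ∩ Δ ⊆ H`, or `c` is on the border and `H ∩ Δ ⊆ N(c)`. In each case two sets are nested, so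
the number `k` of common neighbours in `H` (and the number `l` of those outside) tells which case
applies (`CutEdge.border_iff`). After guessing `a`, `b`, `k`, `l`, all conditions therefore become
constraints of the forms "`u` and `w` are on the same side" and "`u` and `w` are on different
sides". The halfspaces for the guess satisfy them (`CutEdge.feasible_of_cliqueBorders`), and if
there is such a halfspace, then every solution is a halfspace (`CutEdge.cliqueBorders_of_feasible`).

Such a system of constraints falls apart into the components of its constraint graph, on each of
which there are at most two solutions. Taking the better one on each component minimizes the number
of errors (`Feasible.adopt`). The algorithm does this for all `n ^ 4` guesses, checks every result
for clique borders, and keeps the best halfspace found, starting from the empty set and the set of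
all vertices; these are the only halfspaces without cut edges.

The algorithm is written in a language of terms with bounded sums (`RAM.Tm`) and of statements with
bounded loops (`RAM.St`). These have a total denotational semantics, in which correctness is shown,
and are compiled to programs of the machine with a polynomial time bound that is defined along with
the compiler (`RAM.Tm.steps_compile`, `RAM.St.steps_compile`).
-/

namespace RAM

/-! ### A logic for resource bounds -/

/-- `Steps p s T Q`: started with memory `s`, the program `p` halts after at most `T` steps with a
memory that satisfies `Q`. -/
def Steps (p : Program) (s : Memory) (T : ℕ) (Q : Memory → Prop) : Prop :=
  ∃ t s', Runs p s t s' ∧ t ≤ T ∧ Q s'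

theorem Steps.mono {p : Program} {s : Memory} {T T' : ℕ} {Q Q' : Memory → Prop}
    (h : Steps p s T Q) (hT : T ≤ T') (hQ : ∀ s', Q s' → Q' s') : Steps p s T' Q' := by
  obtain ⟨t, s', hr, ht, hq⟩ := h
  exact ⟨t, s', hr, ht.trans hT, hQ _ hq⟩

theorem Steps.seq {p q : Program} {s : Memory} {T T' : ℕ} {Q Q' : Memory → Prop}
    (h : Steps p s T Q) (h' : ∀ s', Q s' → Steps q s' T' Q') :
    Steps (.seq p q) s (T + T') Q' := by
  obtain ⟨t, s', hr, ht, hq⟩ := h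
  obtain ⟨t', s'', hr', ht', hq'⟩ := h' s' hq
  exact ⟨t + t', s'', .seq hr hr', by omega, hq'⟩

theorem Steps.store {k : ℕ} {i e : Expr} {s : Memory} {Q : Memory → Prop}
    (h : Q (write s k (i.eval s) (e.eval s))) :
    Steps (.store k i e) s (1 + i.cost + e.cost) Q :=
  ⟨_, _, .store k i e s, le_rfl, h⟩

theorem Steps.cond {e : Expr} {p q : Program} {s : Memory} {T T' : ℕ} {Q : Memory → Prop}
    (hp : e.eval s ≠ 0 → Steps p s T Q) (hq : e.eval s = 0 → Steps q s T' Q) :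
    Steps (.cond e p q) s (1 + e.cost + T + T') Q := by
  by_cases h : e.eval s = 0
  · obtain ⟨t, s', hr, ht, hQ⟩ := hq h
    exact ⟨_, s', .cond_false p h hr, by omega, hQ⟩
  · obtain ⟨t, s', hr, ht, hQ⟩ := hp h
    exact ⟨_, s', .cond_true q h hr, by omega, hQ⟩

theorem write_apply (s : Memory) (k i x k' j : ℕ) :
    write s k i x k' j = if k' = k ∧ j = i then x else s k' j := by
  unfold write
  by_cases hk : k' = k
  · subst hk
    by_cases hj : j = i
    · subst hj; simp
    · simp [hj]
  · simp [hk]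

theorem write_of_ne (s : Memory) {k k' : ℕ} (i x : ℕ) (h : k' ≠ k) : write s k i x k' = s k' := by
  simp [write, h]

theorem write_same (s : Memory) (k i : ℕ) : write s k i (s k i) = s := by
  simp [write]

theorem write_write (s : Memory) (k i x y : ℕ) : write (write s k i x) k i y = write s k i y := by
  simp [write]

theorem write_congr {s s' : Memory} {k k' : ℕ} (i x : ℕ) (h : s k' = s' k') :
    write s k i x k' = write s' k i x k' := by
  by_cases hk : k' = k
  · subst hk; simp [write, h]
  · simp [write_of_ne _ _ _ hk, h]

/-- The value of a register, i.e. of cell `0` of a bank. -/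
abbrev reg (k : ℕ) : Expr := .load k (.const 0)

/-- Run `p` once for each value of register `v` from `0` to `n - 1`, where `n` is the contents of
register `0`. -/
def forProgram (v : ℕ) (p : Program) : Program :=
  .seq (.store v (.const 0) (.const 0))
    (.loop (.sub (reg 0) (reg v)) (.seq p (.store v (.const 0) (.add (reg v) (.const 1)))))

/-- The invariant `I i` describes the memory when register `v` has just received the value `i`. -/
theorem Steps.forProgram {v : ℕ} {p : Program} {s : Memory} {B n : ℕ} (I : ℕ → Memory → Prop)
    (hn : s 0 0 = n) (hv : v ≠ 0) (h0 : I 0 (write s v 0 0))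
    (hstep : ∀ i < n, ∀ s', I i s' → s' 0 0 = n → s' v 0 = i →
      Steps p s' B fun s'' => s'' 0 0 = n ∧ s'' v 0 = i ∧ I (i + 1) (write s'' v 0 (i + 1))) :
    Steps (forProgram v p) s (9 + n * (12 + B)) fun s' => I n s' ∧ s' 0 0 = n ∧ s' v 0 = n := by
  have key : ∀ m i s', i + m = n → I i s' → s' 0 0 = n → s' v 0 = i →
      Steps (.loop (.sub (reg 0) (reg v)) (.seq p (.store v (.const 0) (.add (reg v) (.const 1)))))
        s' (6 + m * (12 + B)) fun s' => I n s' ∧ s' 0 0 = n ∧ s' v 0 = n := by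
    intro m
    induction m with
    | zero =>
      intro i s' him hI h0 hvi
      obtain rfl : i = n := by omega
      refine ⟨_, s', Runs.loop_stop _ (by simp [Expr.eval, h0, hvi]), by simp [Expr.cost], hI, h0, hvi⟩
    | succ m ih =>
      intro i s' him hI h0 hvi
      obtain ⟨t, s₁, hr, ht, hn₁, hv₁, hI₁⟩ := hstep i (by omega) s' hI h0 hvi
      obtain ⟨t₂, s₂, hr₂, ht₂, hQ⟩ := ih (i + 1) (write s₁ v 0 (i + 1)) (by omega) hI₁
        (by rw [write_of_ne _ _ _ hv.symm, hn₁]) (by simp [write_apply])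
      have hst := Runs.store v (.const 0) (.add (reg v) (.const 1)) s₁
      simp only [Expr.eval, hv₁] at hst
      refine ⟨_, s₂, .loop_step (by simp [Expr.eval, h0, hvi]; omega) (.seq hr hst) hr₂, ?_, hQ⟩
      simp only [Expr.cost, Nat.add_mul] at *
      omega
  refine ((Steps.store (Q := fun s' => s' = write s v 0 0) rfl).seq (T' := 6 + n * (12 + B))
    ?_).mono (by simp [Expr.cost]; omega) fun _ h => h
  rintro _ rfl
  exact key n 0 _ (by omega) h0 (by rw [write_of_ne _ _ _ hv.symm, hn]) (by simp [write_apply])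

/-! ### Terms with bounded sums -/

/-- Terms that may contain a sum over all values of register `v` below `n`, the contents of
register `0`. -/
inductive Tm : Type
  | const (c : ℕ) : Tm
  | load (k : ℕ) (t : Tm) : Tm
  | add (t u : Tm) : Tm
  | sub (t u : Tm) : Tm
  | ite (c t u : Tm) : Tm
  | sum (v : ℕ) (t : Tm) : Tm

namespace Tm

/-- The value of a term. -/
def eval : Tm → Memory → ℕ
  | .const c, _ => c
  | .load k t, s => s k (t.eval s)
  | .add t u, s => t.eval s + u.eval s
  | .sub t u, s => t.eval s - u.eval s
  | .ite c t u, s => if c.eval s ≠ 0 then t.eval s else u.eval s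
  | .sum v t, s => ∑ i ∈ Finset.range (s 0 0), t.eval (write s v 0 i)

/-- All banks that occur in the term are below `r`, and no sum binds register `0`. -/
def ok (r : ℕ) : Tm → Bool
  | .const _ => true
  | .load k t => decide (k < r) && t.ok r
  | .add t u => t.ok r && u.ok r
  | .sub t u => t.ok r && u.ok r
  | .ite c t u => c.ok r && t.ok r && u.ok r
  | .sum v t => decide (0 < v) && decide (v < r) && t.ok r

/-- A program that writes the value of the term into register `r`, and uses only banks from `r` on
as working space; a register bound by a sum gets its old value back, which is kept in register
`r + 1` meanwhile. -/
def compile : Tm → ℕ → Program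
  | .const c, r => .store r (.const 0) (.const c)
  | .load k t, r => .seq (t.compile r) (.store r (.const 0) (.load k (reg r)))
  | .add t u, r => .seq (t.compile r) (.seq (u.compile (r + 1))
      (.store r (.const 0) (.add (reg r) (reg (r + 1)))))
  | .sub t u, r => .seq (t.compile r) (.seq (u.compile (r + 1))
      (.store r (.const 0) (.sub (reg r) (reg (r + 1)))))
  | .ite c t u, r => .seq (c.compile r) (.cond (reg r) (t.compile r) (u.compile r))
  | .sum v t, r => .seq (.store (r + 1) (.const 0) (reg v)) (.seq (.store r (.const 0) (.const 0))
      (.seq (forProgram v (.seq (t.compile (r + 2))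
        (.store r (.const 0) (.add (reg r) (reg (r + 2))))))
      (.store v (.const 0) (reg (r + 1)))))

/-- A bound for the running time of the compiled term as a polynomial in `n`. -/
noncomputable def cost : Tm → Polynomial ℕ
  | .const _ => 3
  | .load _ t => t.cost + 5
  | .add t u => t.cost + u.cost + 7
  | .sub t u => t.cost + u.cost + 7
  | .ite c t u => c.cost + t.cost + u.cost + 3
  | .sum _ t => 20 + Polynomial.X * (20 + t.cost)

theorem eval_congr {r : ℕ} (hr : 0 < r) {t : Tm} (ht : t.ok r) {s s' : Memory}
    (h : ∀ k < r, s k = s' k) : t.eval s = t.eval s' := by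
  induction t generalizing s s' with
  | const c => rfl
  | load k t ih =>
    simp only [ok, Bool.and_eq_true, decide_eq_true_eq] at ht
    simp only [eval, ih ht.2 h, h k ht.1]
  | add t u iht ihu | sub t u iht ihu =>
    simp only [ok, Bool.and_eq_true] at ht
    simp only [eval, iht ht.1 h, ihu ht.2 h]
  | ite c t u ihc iht ihu =>
    simp only [ok, Bool.and_eq_true] at ht
    simp only [eval, ihc ht.1.1 h, iht ht.1.2 h, ihu ht.2 h]
  | sum v t ih =>
    simp only [ok, Bool.and_eq_true, decide_eq_true_eq] at ht
    simp only [eval, h 0 hr]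
    exact Finset.sum_congr rfl fun i _ => ih ht.2 fun k hk => write_congr _ _ (h k hk)

theorem steps_compile {t : Tm} {r : ℕ} (hr : 0 < r) (ht : t.ok r) (s : Memory) :
    Steps (t.compile r) s (t.cost.eval (s 0 0))
      fun s' => s' r 0 = t.eval s ∧ ∀ k < r, s' k = s k := by
  induction t generalizing r s with
  | const c =>
    refine (Steps.store ?_).mono (by simp [Expr.cost, cost]) fun _ h => h
    exact ⟨by simp [write_apply, Expr.eval, eval], fun k hk => write_of_ne _ _ _ hk.ne⟩
  | load k t ih =>
    simp only [ok, Bool.and_eq_true, decide_eq_true_eq] at ht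
    refine ((ih hr ht.2 s).seq (T' := 5) fun s' hs' => ?_).mono (by simp [cost]) fun _ h => h
    refine (Steps.store ?_).mono (by simp [Expr.cost]) fun _ h => h
    refine ⟨?_, fun k hk => by rw [write_of_ne _ _ _ hk.ne, hs'.2 k hk]⟩
    simp [write_apply, Expr.eval, eval, hs'.1, hs'.2 k ht.1]
  | add t u iht ihu | sub t u iht ihu =>
    simp only [ok, Bool.and_eq_true] at ht
    refine ((iht hr ht.1 s).seq (T' := u.cost.eval (s 0 0) + 7) fun s' hs' => ?_).mono
      (by simp [cost]; omega) fun _ h => h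
    have hok : u.ok (r + 1) := by
      have mono : ∀ (u : Tm) r, u.ok r → u.ok (r + 1) := by
        intro u r
        induction u <;> simp only [ok, Bool.and_eq_true, decide_eq_true_eq] at * <;> grind
      exact mono u r ht.2
    refine ((ihu r.succ_pos hok s').seq (T' := 7) fun s'' hs'' => ?_).mono
      (by rw [hs'.2 0 hr]) fun _ h => h
    refine (Steps.store ?_).mono (by simp [Expr.cost]) fun _ h => h
    refine ⟨?_, fun k hk => by
      rw [write_of_ne _ _ _ hk.ne, hs''.2 k (by omega), hs'.2 k hk]⟩
    simp [write_apply, Expr.eval, eval, hs''.1, hs''.2 r (by omega), hs'.1,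
      eval_congr hr ht.2 hs'.2]
  | ite c t u ihc iht ihu =>
    simp only [ok, Bool.and_eq_true] at ht
    refine ((ihc hr ht.1.1 s).seq
      (T' := t.cost.eval (s 0 0) + u.cost.eval (s 0 0) + 3) fun s' hs' => ?_).mono
      (by simp [cost]; omega) fun _ h => h
    have h0 := hs'.2 0 hr
    refine (Steps.cond (T := t.cost.eval (s 0 0)) (T' := u.cost.eval (s 0 0)) (fun hc => ?_)
      fun hc => ?_).mono (by simp [Expr.cost]; omega) fun _ h => h
    · refine (iht hr ht.1.2 s').mono (by rw [h0]) fun s'' hs'' => ⟨?_, fun k hk => ?_⟩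
      · simp only [Expr.eval, hs'.1] at hc
        rw [hs''.1, eval, if_pos hc, eval_congr hr ht.1.2 hs'.2]
      · rw [hs''.2 k hk, hs'.2 k hk]
    · refine (ihu hr ht.2 s').mono (by rw [h0]) fun s'' hs'' => ⟨?_, fun k hk => ?_⟩
      · simp only [Expr.eval, hs'.1] at hc
        rw [hs''.1, eval, if_neg (by simpa using hc), eval_congr hr ht.2 hs'.2]
      · rw [hs''.2 k hk, hs'.2 k hk]
  | sum v t ih =>
    simp only [ok, Bool.and_eq_true, decide_eq_true_eq] at ht
    obtain ⟨⟨hv, hvr⟩, ht⟩ := ht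
    have hok : t.ok (r + 2) := by
      have mono : ∀ (u : Tm) r, u.ok r → u.ok (r + 2) := by
        intro u r
        induction u <;> simp only [ok, Bool.and_eq_true, decide_eq_true_eq] at * <;> grind
      exact mono t r ht
    refine ((Steps.store (Q := fun s' => s' = write s (r + 1) 0 (s v 0)) rfl).seq
      (T' := 16 + s 0 0 * (20 + t.cost.eval (s 0 0))) ?_).mono
      (by simp [cost, Expr.cost]; omega) fun _ h => h
    rintro _ rfl
    refine ((Steps.store (Q := fun s' => s' = write (write s (r + 1) 0 (s v 0)) r 0 0) rfl).seq
      (T' := 13 + s 0 0 * (20 + t.cost.eval (s 0 0))) ?_).mono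
      (by simp [Expr.cost]; omega) fun _ h => h
    rintro _ rfl
    refine ((Steps.forProgram (n := s 0 0) (B := t.cost.eval (s 0 0) + 7)
      (fun i s' => s' r 0 = ∑ j ∈ Finset.range i, t.eval (write s v 0 j) ∧ s' (r + 1) 0 = s v 0 ∧
        ∀ k < r, s' k = write s v 0 i k) ?_ hv.ne' ?_ ?_).seq (T' := 4) ?_).mono
      (by simp only [Nat.mul_add]; omega) fun _ h => h
    · simp [write_apply]; omega
    · refine ⟨by simp [write_apply], by simp [write_apply]; omega, fun k hk => ?_⟩
      apply write_congr
      rw [write_of_ne _ _ _ hk.ne, write_of_ne _ _ _ (by omega)]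
    · rintro i hi s' ⟨hacc, hsave, hlow⟩ h0 hvi
      refine ((ih (by omega) hok s').seq (T' := 7) fun s'' hs'' => ?_).mono
        (by rw [h0]) fun _ h => h
      refine (Steps.store ?_).mono (by simp [Expr.cost]) fun _ h => h
      refine ⟨?_, ?_, ?_, ?_, fun k hk => ?_⟩
      · rw [write_of_ne _ _ _ hr.ne, hs''.2 0 (by omega), h0]
      · rw [write_of_ne _ _ _ hvr.ne, hs''.2 v (by omega), hvi]
      · rw [write_of_ne _ _ _ hvr.ne', Finset.sum_range_succ]
        simp [write_apply, Expr.eval, hs''.1, hs''.2 r (by omega), hacc, eval_congr hr ht hlow]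
      · rw [write_of_ne _ _ _ (by omega), write_of_ne _ _ _ (by omega), hs''.2 _ (by omega), hsave]
      · rw [← write_write s v 0 i]
        apply write_congr
        rw [write_of_ne _ _ _ hk.ne, hs''.2 k (by omega), hlow k hk]
    · rintro s' ⟨⟨hacc, hsave, hlow⟩, -, -⟩
      refine (Steps.store ?_).mono (by simp [Expr.cost]) fun _ h => h
      refine ⟨by rw [write_of_ne _ _ _ hvr.ne']; exact hacc, fun k hk => ?_⟩
      simp only [Expr.eval, hsave]
      rw [write_congr _ _ (hlow k hk), write_write, write_same]

end Tm

/-! ### Statements -/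

/-- Structured programs over terms, with bounded iteration only. -/
inductive St : Type
  /-- write the value of `e` into register `k` -/
  | set (k : ℕ) (e : Tm) : St
  /-- simultaneously for all `i < n`, write the value of `e`, with `i` in register `v`, into cell
  `i` of bank `k` -/
  | fill (k v : ℕ) (e : Tm) : St
  /-- run `p`, then `q` -/
  | seq (p q : St) : St
  /-- run `p` if the value of `e` is not `0` -/
  | when (e : Tm) (p : St) : St
  /-- run `p` once for each value of register `v` from `0` to `n - 1` -/
  | loop (v : ℕ) (p : St) : St

/-- The memory after `i` rounds of a loop with counter `v`, whose body acts on the memory as `f`. -/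
def iter (f : Memory → Memory) (v : ℕ) (s : Memory) : ℕ → Memory
  | 0 => write s v 0 0
  | i + 1 => write (f (iter f v s i)) v 0 (i + 1)

namespace St

/-- The effect of a statement on the memory. -/
def sem : St → Memory → Memory
  | .set k e, s => write s k 0 (e.eval s)
  | .fill k v e, s =>
      Function.update s k fun x => if x < s 0 0 then e.eval (write s v 0 x) else s k x
  | .seq p q, s => q.sem (p.sem s)
  | .when e p, s => if e.eval s ≠ 0 then p.sem s else s
  | .loop v p, s => iter p.sem v s (s 0 0)

/-- The banks that a statement may change. -/
def writes : St → List ℕ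
  | .set k _ => [k]
  | .fill k _ _ => [k]
  | .seq p q => p.writes ++ q.writes
  | .when _ p => p.writes
  | .loop v p => v :: p.writes

/-- All banks that occur in the statement are below `M`, register `0` is not changed, and loop
counters are changed by their loops only. -/
def ok (M : ℕ) : St → Bool
  | .set k e => decide (0 < k) && decide (k < M) && e.ok M
  | .fill k v e => decide (0 < k) && decide (k < M) && (decide (0 < v) && decide (v < M)) &&
      decide (k ≠ v) && e.ok M
  | .seq p q => p.ok M && q.ok M
  | .when e p => e.ok M && p.ok M
  | .loop v p => decide (0 < v) && decide (v < M) && decide (v ∉ p.writes) && p.ok M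

/-- The compiled statement; the banks from `M` on are its working space. For `fill`, the new values
are collected in bank `M` first, since `e` may read bank `k`, and register `M + 1` keeps the old
value of register `v`. -/
def compile (M : ℕ) : St → Program
  | .set k e => .seq (e.compile (M + 1)) (.store k (.const 0) (reg (M + 1)))
  | .fill k v e => .seq (.store (M + 1) (.const 0) (reg v))
      (.seq (forProgram v (.seq (e.compile (M + 2)) (.store M (reg v) (reg (M + 2)))))
      (.seq (forProgram v (.store k (reg v) (.load M (reg v))))
      (.store v (.const 0) (reg (M + 1)))))
  | .seq p q => .seq (p.compile M) (q.compile M)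
  | .when e p => .seq (e.compile (M + 1)) (.cond (reg (M + 1)) (p.compile M) .skip)
  | .loop v p => forProgram v (p.compile M)

/-- A bound for the running time of the compiled statement as a polynomial in `n`. -/
noncomputable def cost : St → Polynomial ℕ
  | .set _ e => e.cost + 4
  | .fill _ _ e => 30 + Polynomial.X * (40 + e.cost)
  | .seq p q => p.cost + q.cost
  | .when e p => e.cost + p.cost + 4
  | .loop _ p => 9 + Polynomial.X * (12 + p.cost)

theorem sem_of_notMem_writes {p : St} {k : ℕ} (hk : k ∉ p.writes) (s : Memory) :
    p.sem s k = s k := by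
  induction p generalizing s with
  | set k' e => exact write_of_ne _ _ _ (by simpa [writes] using hk)
  | fill k' v e => exact Function.update_of_ne (by simpa [writes] using hk) _ _
  | seq p q ihp ihq =>
    simp only [writes, List.mem_append, not_or] at hk
    rw [sem, ihq hk.2, ihp hk.1]
  | when e p ih =>
    rw [sem]
    split_ifs
    · exact ih hk s
    · rfl
  | loop v p ih =>
    simp only [writes, List.mem_cons, not_or] at hk
    rw [sem]
    induction s 0 0 with
    | zero => exact write_of_ne _ _ _ hk.1
    | succ i hi => rw [iter, write_of_ne _ _ _ hk.1, ih hk.2, hi]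

theorem zero_notMem_writes {M : ℕ} {p : St} (h : p.ok M) : 0 ∉ p.writes := by
  induction p <;> simp only [ok, writes, Bool.and_eq_true, decide_eq_true_eq, List.mem_cons,
    List.mem_append] at * <;> grind

theorem steps_compile {M : ℕ} {p : St} (hM : 0 < M) (hp : p.ok M) {s₀ s : Memory}
    (h : ∀ k < M, s₀ k = s k) :
    Steps (p.compile M) s₀ (p.cost.eval (s 0 0)) fun s' => ∀ k < M, s' k = p.sem s k := by
  have okmono : ∀ (u : Tm) {r r'}, r ≤ r' → u.ok r → u.ok r' := by
    intro u r r' h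
    induction u <;> simp only [Tm.ok, Bool.and_eq_true, decide_eq_true_eq] at * <;> grind
  induction p generalizing s₀ s with
  | set k e =>
    simp only [ok, Bool.and_eq_true, decide_eq_true_eq] at hp
    refine ((e.steps_compile M.succ_pos (okmono e (by omega) hp.2) s₀).seq (T' := 4)
      fun s' hs' => ?_).mono (by simp [cost, h 0 hM]) fun _ h => h
    refine (Steps.store ?_).mono (by simp [Expr.cost]) fun _ h => h
    intro j hj
    simp only [Expr.eval, hs'.1, sem, Tm.eval_congr hM hp.2 h]
    exact write_congr _ _ ((hs'.2 j (by omega)).trans (h j hj))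
  | fill k v e =>
    simp only [ok, Bool.and_eq_true, decide_eq_true_eq] at hp
    obtain ⟨⟨⟨⟨hk, hkM⟩, hv, hvM⟩, hkv⟩, he⟩ := hp
    have hn : s₀ 0 0 = s 0 0 := by rw [h 0 hM]
    refine ((Steps.store (Q := fun s' => s' = write s₀ (M + 1) 0 (s₀ v 0)) rfl).seq
      (T' := 26 + s 0 0 * (40 + e.cost.eval (s 0 0))) ?_).mono
      (by simp [cost, Expr.cost]; omega) fun _ h => h
    rintro _ rfl
    refine ((Steps.forProgram (n := s 0 0) (B := e.cost.eval (s 0 0) + 5)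
      (fun i s' => (∀ j < i, s' M j = e.eval (write s v 0 j)) ∧ s' (M + 1) 0 = s v 0 ∧
        ∀ k < M, s' k = write s v 0 i k) ?_ hv.ne' ?_ ?_).seq
        (T' := 17 + s 0 0 * 20) ?_).mono
      (by simp only [Nat.mul_add]; omega) fun _ h => h
    · rw [write_of_ne _ _ _ (by omega), hn]
    · refine ⟨by simp, ?_, fun k hk => ?_⟩
      · rw [write_of_ne _ _ _ (by omega), ← h v hvM]
        simp [write_apply]
      · apply write_congr
        rw [write_of_ne _ _ _ (by omega), h k hk]
    · rintro i hi s' ⟨hacc, hsave, hlow⟩ h0 hvi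
      refine ((e.steps_compile (by omega : 0 < M + 2) (okmono e (by omega) he) s').seq (T' := 5)
        fun s'' hs'' => ?_).mono (by rw [h0]) fun _ h => h
      refine (Steps.store ?_).mono (by simp [Expr.cost]) fun _ h => h
      have hv'' : s'' v 0 = i := by rw [hs''.2 v (by omega), hvi]
      refine ⟨?_, ?_, fun j hj => ?_, ?_, fun k hk => ?_⟩
      · rw [write_of_ne _ _ _ (by omega), hs''.2 0 (by omega), h0]
      · rw [write_of_ne _ _ _ (by omega), hv'']
      · rw [write_of_ne _ _ _ (by omega)]
        simp only [Expr.eval, hv'', hs''.1, write_apply, true_and]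
        split_ifs with hji
        · rw [Tm.eval_congr hM he hlow, hji]
        · rw [hs''.2 M (by omega), hacc j (by omega)]
      · rw [write_of_ne _ _ _ (by omega), write_of_ne _ _ _ (by omega), hs''.2 _ (by omega), hsave]
      · rw [← write_write s v 0 i]
        apply write_congr
        rw [write_of_ne _ _ _ (by omega), hs''.2 k (by omega), hlow k hk]
    rintro s₁ ⟨⟨hacc, hsave, hlow⟩, hn₁, -⟩
    refine ((Steps.forProgram (n := s 0 0) (B := 8)
      (fun i s' => (∀ j, s' k j = if j < i then e.eval (write s v 0 j) else s k j) ∧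
        (∀ j < s 0 0, s' M j = e.eval (write s v 0 j)) ∧ s' (M + 1) 0 = s v 0 ∧
        ∀ k' < M, k' ≠ k → s' k' = write s v 0 i k') hn₁ hv.ne' ?_ ?_).seq
        (T' := 4) ?_).mono (by simp only [Nat.mul_add]; omega) fun _ h => h
    · refine ⟨fun j => ?_, fun j hj => ?_, ?_, fun k' hk' hkk => ?_⟩
      · rw [write_of_ne _ _ _ hkv, hlow k hkM, write_of_ne _ _ _ hkv]
        simp
      · rw [write_of_ne _ _ _ (by omega), hacc j hj]
      · rw [write_of_ne _ _ _ (by omega), hsave]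
      · rw [← write_write s v 0 (s 0 0)]
        exact write_congr _ _ (hlow k' hk')
    · rintro i hi s' ⟨hk', hM', hsave, hlow⟩ h0 hvi
      refine (Steps.store ?_).mono (by simp [Expr.cost]) fun _ h => h
      refine ⟨?_, ?_, fun j => ?_, fun j hj => ?_, ?_, fun k' hk' hkk => ?_⟩
      · rw [write_of_ne _ _ _ (by omega), h0]
      · rw [write_of_ne _ _ _ (by omega), hvi]
      · rw [write_of_ne _ _ _ hkv]
        simp only [Expr.eval, hvi, write_apply, true_and, hM' i hi, hk']
        grind
      · rw [write_of_ne _ _ _ (by omega), write_of_ne _ _ _ (by omega), hM' j hj]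
      · rw [write_of_ne _ _ _ (by omega), write_of_ne _ _ _ (by omega), hsave]
      · rw [← write_write s v 0 i]
        apply write_congr
        rw [write_of_ne _ _ _ hkk, hlow k' hk' hkk]
    rintro s₂ ⟨⟨hk', -, hsave, hlow⟩, -, -⟩
    refine (Steps.store ?_).mono (by simp [Expr.cost]) fun _ h => h
    intro k' hk''
    simp only [Expr.eval, hsave, sem]
    by_cases hkk : k' = k
    · subst hkk
      rw [write_of_ne _ _ _ hkv, Function.update_self]
      exact funext hk'
    · rw [Function.update_of_ne hkk, write_congr _ _ (hlow k' hk'' hkk), write_write, write_same]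
  | seq p q ihp ihq =>
    simp only [ok, Bool.and_eq_true] at hp
    refine ((ihp hp.1 h).seq (T' := q.cost.eval (s 0 0)) fun s' hs' => ?_).mono
      (by simp [cost]) fun _ h => h
    refine (ihq hp.2 hs').mono ?_ fun _ h => h
    rw [sem_of_notMem_writes (zero_notMem_writes hp.1)]
  | when e p ih =>
    simp only [ok, Bool.and_eq_true] at hp
    refine ((e.steps_compile M.succ_pos (okmono e (by omega) hp.1) s₀).seq
      (T' := p.cost.eval (s 0 0) + 4) fun s' hs' => ?_).mono
      (by simp [cost, h 0 hM]; omega) fun _ h => h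
    have hlow : ∀ k < M, s' k = s k := fun k hk => (hs'.2 k (by omega)).trans (h k hk)
    have he : s' (M + 1) 0 = e.eval s := by rw [hs'.1, Tm.eval_congr hM hp.1 h]
    refine (Steps.cond (T := p.cost.eval (s 0 0)) (T' := 1) (fun hc => ?_)
      fun hc => ?_).mono (by simp [Expr.cost]; omega) fun _ h => h
    · simp only [Expr.eval, he] at hc
      simp only [sem, if_pos hc]
      exact ih hp.2 hlow
    · simp only [Expr.eval, he] at hc
      refine ⟨1, s', .skip s', le_rfl, ?_⟩
      simpa only [sem, if_neg (not_not.2 hc)] using hlow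
  | loop v p ih =>
    simp only [ok, Bool.and_eq_true, decide_eq_true_eq] at hp
    obtain ⟨⟨⟨hv, hvM⟩, hvp⟩, hp⟩ := hp
    have hw : ∀ i, iter p.sem v s i 0 0 = s 0 0 ∧ iter p.sem v s i v 0 = i := by
      intro i
      induction i with
      | zero => simp [iter, write_apply]; omega
      | succ i hi =>
        refine ⟨?_, by simp [iter, write_apply]⟩
        rw [iter, write_of_ne _ _ _ (by omega), sem_of_notMem_writes (zero_notMem_writes hp), hi.1]
    refine (Steps.forProgram (n := s 0 0) (B := p.cost.eval (s 0 0))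
      (fun i s' => ∀ k < M, s' k = iter p.sem v s i k) (by rw [h 0 hM]) hv.ne' ?_ ?_).mono
      (by simp [cost]) fun s' hs' => hs'.1
    · exact fun k hk => write_congr _ _ (h k hk)
    · intro i hi s' hs' h0 hvi
      refine (ih hp hs').mono (by rw [(hw i).1]) fun s'' hs'' => ⟨?_, ?_, fun k hk => ?_⟩
      · rw [hs'' 0 hM, sem_of_notMem_writes (zero_notMem_writes hp), (hw i).1]
      · rw [hs'' v hvM, sem_of_notMem_writes hvp, (hw i).2]
      · exact write_congr _ _ (hs'' k hk)

end St

end RAM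

/-! ### Monophonic halfspaces and clique borders -/

section Halfspaces

variable {V : Type*} {G : SimpleGraph V}

/-- Both sides of the cut `(H, Hᶜ)` have clique borders: the ends in `H` of the cut edges are
pairwise equal or adjacent, and so are the ends outside `H`. -/
def CliqueBorders (G : SimpleGraph V) (H : Set V) : Prop :=
  ∀ a b c d, G.Adj a b → G.Adj c d → a ∈ H → b ∉ H → c ∈ H → d ∉ H →
    (a = c ∨ G.Adj a c) ∧ (b = d ∨ G.Adj b d)

theorem CliqueBorders.compl {H : Set V} (h : CliqueBorders G H) : CliqueBorders G Hᶜ := by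
  intro a b c d hab hcd ha hb hc hd
  exact (h b a d c hab.symm hcd.symm (by simpa using hb) ha (by simpa using hd) hc).symm

open SimpleGraph in
/-- An induced path that leaves `H` and returns to it does so at two distinct border vertices; the
edge between them would be a chord. -/
theorem CliqueBorders.mConvex {H : Set V} (h : CliqueBorders G H) : MConvex G H := by
  classical
  rintro u hu v hv w ⟨p, ⟨hp, hind⟩, hw⟩
  by_contra hwH
  obtain ⟨d₁, hd₁, h₁, h₁'⟩ := (p.takeUntil w hw).exists_boundary_dart H hu hwH
  obtain ⟨d₂, hd₂, h₂, h₂'⟩ := (p.dropUntil w hw).exists_boundary_dart Hᶜ hwH (by simpa using hv)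
  rw [Set.mem_compl_iff, not_not] at h₂'
  have hdisj : ∀ x, x ∈ (p.takeUntil w hw).support → x ∈ (p.dropUntil w hw).support → x ∉ H := by
    intro x hx hx'
    have hnd := hp.support_nodup
    rw [← p.take_spec hw, Walk.support_append, List.nodup_append] at hnd
    rw [Walk.mem_support_iff] at hx'
    rcases hx' with rfl | hx'
    · exact hwH
    · exact absurd rfl (hnd.2.2 x hx x hx')
  have hx₁ := Walk.dart_fst_mem_support_of_mem_darts _ hd₁
  have hx₂ := Walk.dart_snd_mem_support_of_mem_darts _ hd₂
  rcases (h d₁.fst d₁.snd d₂.snd d₂.fst d₁.adj d₂.adj.symm h₁ h₁' h₂' h₂).1 with he | he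
  · exact hdisj _ hx₁ (he ▸ hx₂) h₁
  · have hadj := hind ((Walk.mem_verts_toSubgraph p).2 (p.support_takeUntil_subset_support hw hx₁))
      ((Walk.mem_verts_toSubgraph p).2 (p.support_dropUntil_subset_support hw hx₂)) he
    rw [Walk.adj_toSubgraph_iff_mem_edges, ← p.take_spec hw, Walk.edges_append,
      List.mem_append] at hadj
    rcases hadj with hadj | hadj
    · exact hdisj _ (Walk.snd_mem_support_of_mem_edges _ hadj) hx₂ h₂'
    · exact hdisj _ hx₁ (Walk.fst_mem_support_of_mem_edges _ hadj) h₁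

open SimpleGraph in
/-- A shortest walk among those inside a given vertex set is an induced path. -/
theorem isInducedPath_of_minimal {u v : V} {S : Set V} (p : G.Walk u v)
    (hS : ∀ x ∈ p.support, x ∈ S)
    (hmin : ∀ q : G.Walk u v, (∀ x ∈ q.support, x ∈ S) → p.length ≤ q.length) :
    IsInducedPath G p := by
  classical
  have hp : p.IsPath := by
    have hb : p.bypass.length = p.length :=
      le_antisymm p.length_bypass_le_length
        (hmin _ fun x hx => hS x (p.support_bypass_subset_support hx))
    have : p.bypass = p := by
      apply Walk.bypass_eq_self_of_length_le_length_bypass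
      exact hb.ge
    exact this ▸ p.bypass_isPath
  refine ⟨hp, ?_⟩
  -- a chord from `x` to a later vertex `y` would give a shorter walk
  have key : ∀ (x y : V) (hx : x ∈ p.support), G.Adj x y → y ∈ (p.dropUntil x hx).support →
      p.toSubgraph.Adj x y := by
    intro x y hx hxy hy
    have h₁ := hmin ((p.takeUntil x hx).append (.cons hxy ((p.dropUntil x hx).dropUntil y hy))) (by
      intro z hz
      rw [Walk.mem_support_append_iff, Walk.support_cons, List.mem_cons] at hz
      rcases hz with hz | rfl | hz
      · exact hS z (p.support_takeUntil_subset_support hx hz)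
      · exact hS z hx
      · exact hS z (p.support_dropUntil_subset_support hx
          (Walk.support_dropUntil_subset_support _ hy hz)))
    have h₂ := congrArg Walk.length (p.take_spec hx)
    have h₃ := congrArg Walk.length ((p.dropUntil x hx).take_spec hy)
    simp only [Walk.length_append, Walk.length_cons] at h₁ h₂ h₃
    have h₄ : s(x, y) ∈ ((p.dropUntil x hx).takeUntil y hy).edges := by
      generalize ((p.dropUntil x hx).takeUntil y hy) = q at h₃
      match q, h₃ with
      | .nil, _ => exact absurd rfl hxy.ne
      | .cons _ .nil, _ => simp
      | .cons _ (.cons _ _), h₃ => simp only [Walk.length_cons] at h₃; omega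
    rw [Walk.adj_toSubgraph_iff_mem_edges]
    exact p.edges_dropUntil_subset_edges hx (Walk.edges_takeUntil_subset_edges _ hy h₄)
  intro x hx y hy hxy
  rw [Walk.mem_verts_toSubgraph] at hx hy
  have hy' := hy
  rw [← p.take_spec hx, Walk.mem_support_append_iff] at hy'
  rcases hy' with hy' | hy'
  · refine (key y x hy hxy.symm ?_).symm
    have hx' := hx
    rw [← p.take_spec hy, Walk.mem_support_append_iff] at hx'
    rcases hx' with hx' | hx'
    · -- both `x` precedes `y` and `y` precedes `x`, which is impossible for distinct vertices
      exfalso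
      have h₁ := congrArg Walk.length (p.take_spec hx)
      have h₂ := Walk.length_takeUntil_lt_length hx' hxy.ne
      have h₃ := Walk.length_takeUntil_lt_length hy' hxy.ne'
      rw [Walk.takeUntil_takeUntil] at h₂ h₃
      omega
    · exact hx'
  · exact key x y hx hxy hy'

open SimpleGraph in
/-- A shortest path between two ends outside of `H` avoids `H`; if the ends `a`, `c` in `H` were
distinct and not adjacent, then a shortest detour through such vertices would be an induced path
that leaves `H`. -/
theorem IsMHalfspace.border_left {H : Set V} (hG : G.Connected) (h : IsMHalfspace G H)
    {a b c d : V} (hab : G.Adj a b) (hcd : G.Adj c d) (ha : a ∈ H) (hb : b ∉ H) (hc : c ∈ H)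
    (hd : d ∉ H) : a = c ∨ G.Adj a c := by
  classical
  by_contra! hcon
  obtain ⟨q, hq⟩ := (hG b d).exists_walk_length_eq_dist
  have hqH : ∀ x ∈ q.support, x ∉ H := by
    intro x hx
    refine h.2 b hb d hd ⟨q, isInducedPath_of_minimal (S := Set.univ) q (by simp) ?_, hx⟩
    intro q' _
    rw [hq]
    exact dist_le q'
  have hex : ∃ m, ∃ p : G.Walk a c, p.length = m ∧ ∀ x ∈ p.support, x ∈ Hᶜ ∪ {a, c} := by
    refine ⟨_, .cons hab (q.concat hcd.symm), rfl, fun x hx => ?_⟩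
    rw [Walk.support_cons, Walk.support_concat, List.mem_cons, List.mem_append] at hx
    rcases hx with rfl | hx | hx
    · simp
    · exact .inl (hqH x hx)
    · simp_all
  obtain ⟨p, hpl, hpS⟩ := Nat.find_spec hex
  have hind := isInducedPath_of_minimal p hpS fun p' hp' =>
    hpl ▸ Nat.find_min' hex ⟨p', rfl, hp'⟩
  have hpH : ∀ x ∈ p.support, x ∈ H := fun x hx => h.1 a ha c hc ⟨p, hind, hx⟩
  match p, hpS, hpH with
  | .nil, _, _ => exact hcon.1 rfl
  | .cons (v := x) hax r, hpS, hpH =>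
    have hx : x ∈ (Walk.cons hax r).support := by simp
    rcases hpS x hx with hx' | rfl | hx'
    · exact hx' (hpH x hx)
    · exact hax.ne rfl
    · exact hcon.2 (hx' ▸ hax)

theorem isMHalfspace_iff_cliqueBorders (hG : G.Connected) {H : Set V} :
    IsMHalfspace G H ↔ CliqueBorders G H := by
  refine ⟨fun h a b c d hab hcd ha hb hc hd => ⟨h.border_left hG hab hcd ha hb hc hd, ?_⟩,
    fun h => ⟨h.mConvex, h.compl.mConvex⟩⟩
  have hc' : IsMHalfspace G Hᶜ := ⟨h.2, by simpa using h.1⟩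
  exact hc'.border_left hG hab.symm hcd.symm hb (by simpa using ha) hd (by simpa using hc)

end Halfspaces

/-! ### Halfspaces with a given cut edge -/

namespace CutEdge

variable {V : Type*} (G : SimpleGraph V)

/-- The vertices in `N(a) \ N[b]`. -/
def Private (a b c : V) : Prop :=
  G.Adj a c ∧ c ≠ b ∧ ¬ G.Adj b c

/-- The vertices in `N(a) ∩ N(b)`. -/
def Common (a b c : V) : Prop :=
  G.Adj a c ∧ G.Adj b c

/-- The vertices outside `N[a] ∪ N[b]`. -/
def Far (a b c : V) : Prop :=
  c ≠ a ∧ c ≠ b ∧ ¬ G.Adj a c ∧ ¬ G.Adj b c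

open Classical in
/-- The private neighbours `c` of `a` that are on the border of a halfspace that contains `a` but
not `b`, if the halfspace contains exactly `k` common neighbours of `a` and `b`. -/
def Border [Fintype V] (a b : V) (k : ℕ) (c : V) : Prop :=
  k < Finset.card {d | Common G a b d ∧ G.Adj c d} ∨ ∃ d, Private G b a d ∧ G.Adj c d

/-- Neighbours `w ≠ b` of `a` that every halfspace contains that contains `a` but not `b`, and
contains exactly `k` of the common neighbours of `a` and `b` while `l` are outside. -/
def Forced [Fintype V] (a b : V) (k l : ℕ) (w : V) : Prop :=
  Private G a b w ∨ Common G a b w ∧ ∃ c,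
    Private G a b c ∧ ¬ Border G a b k c ∧ G.Adj c w ∨
    Private G b a c ∧ Border G b a l c ∧ ¬ G.Adj c w

/-- The vertices `u` and `w` are on the same side of the cut. -/
def Same [Fintype V] (a b : V) (k l : ℕ) (u w : V) : Prop :=
  G.Adj u w ∧ (Far G a b u ∨ Far G a b w) ∨ u = a ∧ Forced G a b k l w ∨
    w = a ∧ Forced G a b k l u

/-- The vertices `u` and `w` are on different sides of the cut. -/
def Diff [Fintype V] (a b : V) (k l : ℕ) (u w : V) : Prop :=
  Common G a b u ∧ Common G a b w ∧ u ≠ w ∧ ¬ G.Adj u w ∨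
    u = a ∧ (w = b ∨ Forced G b a l k w) ∨ w = a ∧ (u = b ∨ Forced G b a l k u)

end CutEdge

/-- The sets that contain `a` and respect the constraints `E` (same side) and `D` (different
sides). -/
structure Feasible {V : Type*} (E D : V → V → Prop) (a : V) (H : Set V) : Prop where
  mem : a ∈ H
  same : ∀ u w, E u w → (u ∈ H ↔ w ∈ H)
  diff : ∀ u w, D u w → (u ∈ H ↔ w ∉ H)

namespace CutEdge

variable {V : Type*} {G : SimpleGraph V} {a b : V} {H : Set V}

theorem Common.symm {c : V} (h : Common G a b c) : Common G b a c := ⟨h.2, h.1⟩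

theorem common_comm : Common G a b = Common G b a :=
  funext fun _ => propext and_comm

/-- `k` of the common neighbours of `a` and `b` are in `H`, and `l` are not. -/
def Counts (G : SimpleGraph V) (a b : V) (k l : ℕ) (H : Set V) : Prop :=
  Set.ncard {d | Common G a b d ∧ d ∈ H} = k ∧ Set.ncard {d | Common G a b d ∧ d ∉ H} = l

theorem Counts.compl {k l : ℕ} (h : Counts G a b k l H) : Counts G b a l k Hᶜ := by
  rw [Counts, common_comm]
  exact ⟨h.2, by simpa using h.1⟩

theorem mem_of_private (hH : CliqueBorders G H) (hab : G.Adj a b) (ha : a ∈ H) (hb : b ∉ H) {c : V}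
    (hc : Private G a b c) : c ∈ H := by
  by_contra h
  have := (hH a b a c hab hc.1 ha hb ha h).2
  exact this.elim (fun h => hc.2.1 h.symm) hc.2.2

variable [Fintype V]

/-- `Border` tells exactly which private neighbours of `a` are on the border: the common neighbours
of `a` and `b` in `H` are on the border, so they are adjacent to such a `c`, and `c` has a further
neighbour outside `H`. -/
theorem border_iff (hH : CliqueBorders G H) (hab : G.Adj a b) (ha : a ∈ H) (hb : b ∉ H) {k l : ℕ}
    (hk : Counts G a b k l H) {c : V} (hc : Private G a b c) :
    Border G a b k c ↔ ∃ d, G.Adj c d ∧ d ∉ H := by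
  classical
  have hcH := mem_of_private hH hab ha hb hc
  have hk' : Finset.card {d | Common G a b d ∧ d ∈ H} = k := by
    rw [← hk.1, ← Set.ncard_coe_finset]
    simp
  constructor
  · rintro (h | ⟨d, hd, hcd⟩)
    · by_contra! hcon
      refine absurd h (not_lt.2 (hk' ▸ Finset.card_le_card fun d => ?_))
      simp only [Finset.mem_filter, Finset.mem_univ, true_and]
      exact fun hd => ⟨hd.1, hcon d hd.2⟩
    · have := mem_of_private hH.compl hab.symm hb (by simpa using ha) hd
      exact ⟨d, hcd, this⟩
  · rintro ⟨d, hcd, hd⟩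
    have hbd : b = d ∨ G.Adj b d := (hH a b c d hab hcd ha hb hcH hd).2
    have hbd : G.Adj b d := hbd.resolve_left fun h => hc.2.2 (h ▸ hcd.symm)
    by_cases had : G.Adj a d
    · left
      rw [← hk']
      refine Finset.card_lt_card (Finset.ssubset_iff_of_subset ?_ |>.2 ⟨d, ?_, ?_⟩)
      · intro e
        simp only [Finset.mem_filter, Finset.mem_univ, true_and]
        rintro ⟨he, heH⟩
        refine ⟨he, ?_⟩
        refine ((hH c d e b hcd he.2.symm hcH hd heH hb).1).resolve_left ?_
        rintro rfl
        exact hc.2.2 he.2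
      · simpa using ⟨⟨had, hbd⟩, hcd⟩
      · simp [hd]
    · exact .inr ⟨d, ⟨hbd, fun h => hd (h ▸ ha), had⟩, hcd⟩

theorem mem_of_forced (hH : CliqueBorders G H) (hab : G.Adj a b) (ha : a ∈ H) (hb : b ∉ H)
    {k l : ℕ} (hk : Counts G a b k l H) {w : V} (hw : Forced G a b k l w) : w ∈ H := by
  rcases hw with hw | ⟨hw, c, ⟨hc, hβ, hcw⟩ | ⟨hc, hβ, hcw⟩⟩
  · exact mem_of_private hH hab ha hb hw
  · rw [border_iff hH hab ha hb hk hc] at hβ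
    by_contra h
    exact hβ ⟨w, hcw, h⟩
  · have ha' : a ∉ Hᶜ := by simpa using ha
    rw [border_iff hH.compl hab.symm hb ha' hk.compl hc] at hβ
    obtain ⟨d, hcd, hd⟩ := hβ
    have hcH := mem_of_private hH.compl hab.symm hb ha' hc
    by_contra h
    rcases (hH.compl c d w a hcd hw.1.symm hcH hd h ha').1 with rfl | h'
    · exact hc.2.2 hw.1
    · exact hcw h'

/-- Every halfspace that separates `a` from `b` respects the constraints. -/
theorem feasible_of_cliqueBorders (hH : CliqueBorders G H) (hab : G.Adj a b) (ha : a ∈ H)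
    (hb : b ∉ H) {k l : ℕ} (hk : Counts G a b k l H) :
    Feasible (Same G a b k l) (Diff G a b k l) a H := by
  have ha' : a ∉ Hᶜ := by simpa using ha
  have far : ∀ u w, G.Adj u w → Far G a b u → (u ∈ H ↔ w ∈ H) := by
    intro u w huw hu
    constructor
    · intro h
      by_contra h'
      exact (hH a b u w hab huw ha hb h h').1.elim (fun h => hu.1 h.symm) hu.2.2.1
    · intro h
      by_contra h'
      exact (hH a b w u hab huw.symm ha hb h h').2.elim (fun h => hu.2.1 h.symm) hu.2.2.2
  have zero : ∀ w, w = b ∨ Forced G b a l k w → w ∉ H := by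
    rintro w (rfl | h)
    · exact hb
    · exact mem_of_forced hH.compl hab.symm hb ha' hk.compl h
  refine ⟨ha, ?_, ?_⟩
  · rintro u w (⟨huw, hu | hw⟩ | ⟨rfl, h⟩ | ⟨rfl, h⟩)
    · exact far u w huw hu
    · exact (far w u huw.symm hw).symm
    · exact iff_of_true ha (mem_of_forced hH hab ha hb hk h)
    · exact iff_of_true (mem_of_forced hH hab ha hb hk h) ha
  · rintro u w (⟨hu, hw, hne, huw⟩ | ⟨rfl, h⟩ | ⟨rfl, h⟩)
    · constructor
      · intro h h'
        exact (hH u b w b hu.2.symm hw.2.symm h hb h' hb).1.elim hne huw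
      · intro h
        by_contra h'
        exact (hH a u a w hu.1 hw.1 ha h' ha h).2.elim hne huw
    · exact iff_of_true ha (zero w h)
    · exact iff_of_false (zero u h) (by simpa using ha)

/-- The constraints, read as conditions on `a` and its side only, so that they pass to the
complement when `a` and `b` are exchanged. -/
structure Respects (G : SimpleGraph V) (a b : V) (k l : ℕ) (F : Set V) : Prop where
  left : a ∈ F
  right : b ∉ F
  far : ∀ u w, G.Adj u w → Far G a b u → (u ∈ F ↔ w ∈ F)
  mem : ∀ w, Forced G a b k l w → w ∈ F
  notMem : ∀ w, Forced G b a l k w → w ∉ F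
  diff : ∀ u w, Common G a b u → Common G a b w → u ≠ w → ¬ G.Adj u w → (u ∈ F ↔ w ∉ F)

theorem Respects.compl {k l : ℕ} {F : Set V} (h : Respects G a b k l F) :
    Respects G b a l k Fᶜ where
  left := h.right
  right := by simpa using h.left
  far u w huw hu := not_congr (h.far u w huw ⟨hu.2.1, hu.1, hu.2.2.2, hu.2.2.1⟩)
  mem := h.notMem
  notMem w hw := by simpa using h.mem w hw
  diff u w hu hw hne huw := not_congr (h.diff u w hu.symm hw.symm hne huw)

theorem Feasible.respects {k l : ℕ} {F : Set V}
    (h : Feasible (Same G a b k l) (Diff G a b k l) a F) : Respects G a b k l F where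
  left := h.mem
  right := (h.diff a b (.inr (.inl ⟨rfl, .inl rfl⟩))).1 h.mem
  far u w huw hu := h.same u w (.inl ⟨huw, .inl hu⟩)
  mem w hw := (h.same a w (.inr (.inl ⟨rfl, hw⟩))).1 h.mem
  notMem w hw := (h.diff a w (.inr (.inl ⟨rfl, .inr hw⟩))).1 h.mem
  diff u w hu hw hne huw := h.diff u w (.inl ⟨hu, hw, hne, huw⟩)

/-- A vertex on the border of a set that respects the constraints is `a` itself, a common neighbour
of `a` and `b`, or a private neighbour of `a` for which `Border` holds. -/
theorem Respects.cases {k l : ℕ} {F : Set V} (h : Respects G a b k l F) {c d : V}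
    (hcd : G.Adj c d) (hc : c ∈ F) (hd : d ∉ F) :
    c = a ∨ Common G a b c ∨ Private G a b c ∧ Border G a b k c := by
  have hcb : c ≠ b := by rintro rfl; exact h.right hc
  have hda : d ≠ a := by rintro rfl; exact hd h.left
  have hcF : ¬ Far G a b c := fun hf => hd ((h.far c d hcd hf).1 hc)
  have hdF : ¬ Far G a b d := fun hf => hd ((h.far d c hcd.symm hf).2 hc)
  have hcB : ¬ Private G b a c := fun hB => h.notMem c (.inl hB) hc
  have hdA : ¬ Private G a b d := fun hA => hd (h.mem d (.inl hA))
  by_cases hac : c = a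
  · exact .inl hac
  by_cases hadj : G.Adj a c
  · by_cases hbc : G.Adj b c
    · exact .inr (.inl ⟨hadj, hbc⟩)
    have hcA : Private G a b c := ⟨hadj, hcb, hbc⟩
    refine .inr (.inr ⟨hcA, ?_⟩)
    by_contra hβ
    have hdb : d ≠ b := by rintro rfl; exact hbc hcd.symm
    by_cases hbd : G.Adj b d
    · by_cases had : G.Adj a d
      · exact hd (h.mem d (.inr ⟨⟨had, hbd⟩, c, .inl ⟨hcA, hβ, hcd⟩⟩))
      · exact hβ (.inr ⟨d, ⟨hbd, hda, had⟩, hcd⟩)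
    · by_cases had : G.Adj a d
      · exact hdA ⟨had, hdb, hbd⟩
      · exact hdF ⟨hda, hdb, had, hbd⟩
  · by_cases hbc : G.Adj b c
    · exact (hcB ⟨hbc, hac, hadj⟩).elim
    · exact (hcF ⟨hac, hcb, hadj, hbc⟩).elim

theorem Respects.border_left {k l : ℕ} {F : Set V} (h : Respects G a b k l F)
    (hH : CliqueBorders G H) (hab : G.Adj a b) (ha : a ∈ H) (hb : b ∉ H) (hk : Counts G a b k l H)
    {c d c' d' : V} (hcd : G.Adj c d) (hcd' : G.Adj c' d') (hc : c ∈ F) (hd : d ∉ F) (hc' : c' ∈ F)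
    (hd' : d' ∉ F) : c = c' ∨ G.Adj c c' := by
  have mixed : ∀ c c', c' ∈ F → Private G a b c → Border G a b k c → Common G a b c' →
      G.Adj c c' := by
    intro c c' hc' hc hβ hcom
    by_contra hne
    exact h.notMem c' (.inr ⟨hcom.symm, c, .inr ⟨hc, hβ, hne⟩⟩) hc'
  rcases h.cases hcd hc hd with rfl | h₁ | ⟨h₁, hβ₁⟩ <;>
    rcases h.cases hcd' hc' hd' with rfl | h₂ | ⟨h₂, hβ₂⟩
  · exact .inl rfl
  · exact .inr h₂.1
  · exact .inr h₂.1
  · exact .inr h₁.1.symm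
  · by_contra! hcon
    exact (h.diff c c' h₁ h₂ hcon.1 hcon.2).1 hc hc'
  · exact .inr (mixed c' c hc h₂ hβ₂ h₁).symm
  · exact .inr h₁.1.symm
  · exact .inr (mixed c c' hc' h₁ hβ₁ h₂)
  · obtain ⟨e, hce, he⟩ := (border_iff hH hab ha hb hk h₁).1 hβ₁
    obtain ⟨e', hce', he'⟩ := (border_iff hH hab ha hb hk h₂).1 hβ₂
    exact (hH c e c' e' hce hce' (mem_of_private hH hab ha hb h₁) he
      (mem_of_private hH hab ha hb h₂) he').1

/-- If the constraints come from some halfspace `H` that separates `a` from `b`, then every set that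
respects them is a halfspace. -/
theorem cliqueBorders_of_feasible (hH : CliqueBorders G H) (hab : G.Adj a b) (ha : a ∈ H)
    (hb : b ∉ H) {k l : ℕ} (hk : Counts G a b k l H) {F : Set V}
    (hF : Feasible (Same G a b k l) (Diff G a b k l) a F) : CliqueBorders G F := by
  have h := Feasible.respects hF
  intro c d c' d' hcd hcd' hc hd hc' hd'
  exact ⟨h.border_left hH hab ha hb hk hcd hcd' hc hd hc' hd',
    h.compl.border_left hH.compl hab.symm hb (by simpa using ha) hk.compl hcd.symm hcd'.symm
      hd (by simpa using hc) hd' (by simpa using hc')⟩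

theorem Same.symm {k l : ℕ} {u w : V} (h : Same G a b k l u w) : Same G a b k l w u := by
  rcases h with ⟨h, h'⟩ | h | h
  · exact .inl ⟨h.symm, h'.symm⟩
  · exact .inr (.inr h)
  · exact .inr (.inl h)

theorem Diff.symm {k l : ℕ} {u w : V} (h : Diff G a b k l u w) : Diff G a b k l w u := by
  rcases h with ⟨h₁, h₂, h₃, h₄⟩ | h | h
  · exact .inl ⟨h₂, h₁, h₃.symm, fun h => h₄ h.symm⟩
  · exact .inr (.inr h)
  · exact .inr (.inl h)

end CutEdge

/-! ### Improving a feasible set one component at a time -/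

section Greedy

variable {V : Type*}

open Classical in
/-- One round of propagation along the constraints. The value `Q w` is `2` if `w` is known to be on
the same side as the start vertex, `1` if it is known to be on the other side, and `0` if nothing is
known. -/
noncomputable def propagate (E D : V → V → Prop) (Q : V → ℕ) (w : V) : ℕ :=
  if Q w ≠ 0 then Q w
  else if ∃ u, Q u = 2 ∧ E u w ∨ Q u = 1 ∧ D u w then 2
  else if ∃ u, Q u = 1 ∧ E u w ∨ Q u = 2 ∧ D u w then 1
  else 0

/-- The known part is a union of components of the constraint graph. -/
def Closed (E D : V → V → Prop) (Q : V → ℕ) : Prop :=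
  ∀ u w, E u w ∨ D u w → Q u ≠ 0 → Q w ≠ 0

/-- `Q` is correct for the set `H` and the start vertex `v`. -/
structure Agrees (v : V) (H : Set V) (Q : V → ℕ) : Prop where
  start : Q v = 2
  le_two : ∀ w, Q w ≤ 2
  same : ∀ w, Q w = 2 → (w ∈ H ↔ v ∈ H)
  diff : ∀ w, Q w = 1 → (w ∈ H ↔ v ∉ H)

theorem Agrees.propagate {E D : V → V → Prop} {a v : V} {H : Set V} {Q : V → ℕ}
    (hH : Feasible E D a H) (h : Agrees v H Q) : Agrees v H (propagate E D Q) := by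
  classical
  refine ⟨by simp [_root_.propagate, h.start], fun w => ?_, fun w hw => ?_, fun w hw => ?_⟩
  · have := h.le_two w
    unfold _root_.propagate
    split_ifs <;> omega
  · unfold _root_.propagate at hw
    split_ifs at hw with h₁ h₂ h₃
    · exact h.same w hw
    · obtain ⟨u, ⟨hu, huw⟩ | ⟨hu, huw⟩⟩ := h₂
      · exact (hH.same u w huw).symm.trans (h.same u hu)
      · have := hH.diff u w huw
        have := h.diff u hu
        tauto
    · omega
  · unfold _root_.propagate at hw
    split_ifs at hw with h₁ h₂ h₃
    · exact h.diff w hw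
    · omega
    · obtain ⟨u, ⟨hu, huw⟩ | ⟨hu, huw⟩⟩ := h₃
      · exact (hH.same u w huw).symm.trans (h.diff u hu)
      · have := hH.diff u w huw
        have := h.same u hu
        tauto

open Classical in
/-- Each round of propagation reaches a new vertex, or else the known part is closed. -/
theorem closed_propagate_or [Fintype V] {E D : V → V → Prop} {Q : V → ℕ} (hQ : ∀ w, Q w ≤ 2) {m : ℕ}
    (h : Closed E D Q ∨ m ≤ Finset.card {w | Q w ≠ 0}) :
    Closed E D (propagate E D Q) ∨ m + 1 ≤ Finset.card {w | propagate E D Q w ≠ 0} := by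
  by_cases hcl : Closed E D Q
  · left
    have : propagate E D Q = Q := by
      funext w
      by_cases hw : Q w = 0
      · have hno : ∀ u, E u w ∨ D u w → Q u = 0 := fun u hu => by
          by_contra h'
          exact hcl u w hu h' hw
        have h₁ : ¬ ∃ u, Q u = 2 ∧ E u w ∨ Q u = 1 ∧ D u w := by
          rintro ⟨u, ⟨h₁, h₂⟩ | ⟨h₁, h₂⟩⟩
          · have := hno u (.inl h₂); omega
          · have := hno u (.inr h₂); omega
        have h₂ : ¬ ∃ u, Q u = 1 ∧ E u w ∨ Q u = 2 ∧ D u w := by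
          rintro ⟨u, ⟨h₁, h₂⟩ | ⟨h₁, h₂⟩⟩
          · have := hno u (.inl h₂); omega
          · have := hno u (.inr h₂); omega
        rw [propagate, if_neg (not_not.2 hw), if_neg h₁, if_neg h₂, hw]
      · simp [propagate, hw]
    rwa [this]
  · right
    have hm := h.resolve_left hcl
    refine Nat.succ_le_of_lt (hm.trans_lt (Finset.card_lt_card ?_))
    unfold Closed at hcl
    push Not at hcl
    obtain ⟨u, w, huw, hu, hw⟩ := hcl
    refine Finset.ssubset_iff_of_subset ?_ |>.2 ⟨w, ?_, by simpa using hw⟩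
    · intro x
      simp only [Finset.mem_filter, Finset.mem_univ, true_and]
      intro hx
      simp [propagate, hx]
    · simp only [Finset.mem_filter, Finset.mem_univ, true_and]
      have hu' : Q u = 1 ∨ Q u = 2 := by have := hQ u; omega
      rw [propagate, if_neg (not_not.2 hw)]
      split_ifs with h₁ h₂
      · simp
      · simp
      · exfalso
        rcases hu' with hu' | hu' <;> rcases huw with huw | huw
        · exact h₂ ⟨u, .inl ⟨hu', huw⟩⟩
        · exact h₁ ⟨u, .inr ⟨hu', huw⟩⟩
        · exact h₁ ⟨u, .inl ⟨hu', huw⟩⟩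
        · exact h₂ ⟨u, .inr ⟨hu', huw⟩⟩

variable [Fintype V] (X : V → SignType)

open Classical in
/-- The number of labelled vertices that `H` misclassifies. -/
noncomputable def errors (H : Set V) : ℕ :=
  Finset.card {w | X w = 1 ∧ w ∉ H ∨ X w = -1 ∧ w ∈ H}

theorem empiricalRisk_eq (H : Set V) :
    empiricalRisk X H = 1 / ((sampleSupport X).card : ℚ) * errors X H := by
  classical
  rw [empiricalRisk, errors, Finset.sum_boole]
  congr 3
  ext w
  simp only [sampleSupport, Finset.mem_filter, Finset.mem_univ, true_and, signVector]
  rcases SignType.trichotomy (X w) with h | h | h <;> by_cases hw : w ∈ H <;> simp [h, hw]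

theorem empiricalRisk_le {H H' : Set V} (h : errors X H ≤ errors X H') :
    empiricalRisk X H ≤ empiricalRisk X H' := by
  rw [empiricalRisk_eq, empiricalRisk_eq]
  have : (errors X H : ℚ) ≤ errors X H' := by exact_mod_cast h
  gcongr

theorem errors_le (H : Set V) : errors X H ≤ Fintype.card V :=
  Finset.card_le_univ _

open Classical in
/-- The number of misclassified vertices in the known part if the start vertex is in the set. -/
noncomputable def keepErrors (Q : V → ℕ) : ℕ :=
  Finset.card {w | X w = 1 ∧ Q w = 1 ∨ X w = -1 ∧ Q w = 2}

open Classical in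
/-- The number of misclassified vertices in the known part if the start vertex is not in the set. -/
noncomputable def flipErrors (Q : V → ℕ) : ℕ :=
  Finset.card {w | X w = 1 ∧ Q w = 2 ∨ X w = -1 ∧ Q w = 1}

/-- Whether to put the start vertex outside the set: the vertex `a` has to be in the set, and the
number of errors decides if the side of `a` is not known. -/
def Flip (a : V) (Q : V → ℕ) : Prop :=
  Q a = 1 ∨ Q a = 0 ∧ flipErrors X Q < keepErrors X Q

open Classical in
/-- The partial assignment `c` (`2` for membership, `1` for non-membership, `0` for undecided) after
the better of the two choices on the known part has been adopted. -/
noncomputable def adopt (a : V) (Q c : V → ℕ) (w : V) : ℕ :=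
  if Q w ≠ 0 then if Flip X a Q then 3 - Q w else Q w else c w

/-- `H` extends the partial assignment `c`. -/
def Extends (H : Set V) (c : V → ℕ) : Prop :=
  ∀ w, (c w = 2 → w ∈ H) ∧ (c w = 1 → w ∉ H)

omit [Fintype V] in
/-- Exchanging the sides on a union of components preserves feasibility. -/
theorem Feasible.exchange {E D : V → V → Prop} (hE : ∀ u w, E u w → E w u)
    (hD : ∀ u w, D u w → D w u) {a : V} {H : Set V} {Q : V → ℕ} (hH : Feasible E D a H)
    (hcl : Closed E D Q) (ha : Q a = 0) :
    Feasible E D a {w | if Q w = 0 then w ∈ H else w ∉ H} := by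
  have hiff : ∀ u w, E u w ∨ D u w → (Q u = 0 ↔ Q w = 0) := by
    intro u w h
    have h₁ := hcl u w h
    have h₂ := hcl w u (h.imp (hE u w) (hD u w))
    tauto
  refine ⟨by simpa [ha] using hH.mem, fun u w h => ?_, fun u w h => ?_⟩
  · have h₁ := hiff u w (.inl h)
    have h₂ := hH.same u w h
    by_cases hw : Q w = 0
    · simpa [hw, h₁.2 hw] using h₂
    · simpa [hw, mt h₁.1 hw] using not_congr h₂
  · have h₁ := hiff u w (.inr h)
    have h₂ := hH.diff u w h
    by_cases hw : Q w = 0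
    · simpa [hw, h₁.2 hw] using h₂
    · simpa [hw, mt h₁.1 hw] using not_congr h₂

/-- The exchange argument: a feasible set that extends the partial assignment can be changed on the
known part, without more errors, so that it extends the new partial assignment. -/
theorem Feasible.adopt {E D : V → V → Prop} (hE : ∀ u w, E u w → E w u)
    (hD : ∀ u w, D u w → D w u) {a v : V} {H : Set V} {Q c : V → ℕ} (hH : Feasible E D a H)
    (hcl : Closed E D Q) (hQ : Agrees v H Q) (hc : Extends H c) :
    ∃ H', Feasible E D a H' ∧ errors X H' ≤ errors X H ∧ Extends H' (adopt X a Q c) := by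
  classical
  have hQ' : ∀ w, Q w = 0 ∨ Q w = 1 ∨ Q w = 2 := fun w => by have := hQ.le_two w; omega
  have key := fun w => And.intro (hQ.same w) (hQ.diff w)
  by_cases hfit : v ∈ H ↔ ¬ Flip X a Q
  · -- `H` itself makes the adopted choice
    refine ⟨H, hH, le_rfl, fun w => ?_⟩
    have := key w
    have := hc w
    rcases hQ' w with h | h | h <;> by_cases hf : Flip X a Q <;> simp_all [_root_.adopt]
  · have ha : Q a = 0 := by
      have hka := key a
      have hm := hH.mem
      by_contra h
      rcases hQ' a with h' | h' | h'
      · exact h h'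
      · have : Flip X a Q := .inl h'
        tauto
      · have : ¬ Flip X a Q := by rintro (h | h) <;> omega
        tauto
    refine ⟨_, hH.exchange hE hD hcl ha, ?_, fun w => ?_⟩
    · have hf : Flip X a Q ↔ flipErrors X Q < keepErrors X Q := by simp [Flip, ha]
      have hsum : errors X {w | if Q w = 0 then w ∈ H else w ∉ H} +
          (if v ∈ H then keepErrors X Q else flipErrors X Q) =
          errors X H + (if v ∈ H then flipErrors X Q else keepErrors X Q) := by
        simp only [errors, keepErrors, flipErrors, Finset.card_filter]
        by_cases hv : v ∈ H
        · simp only [hv, if_true, ← Finset.sum_add_distrib]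
          refine Finset.sum_congr rfl fun w _ => ?_
          have := key w
          rcases SignType.trichotomy (X w) with hX | hX | hX <;>
            rcases hQ' w with h | h | h <;> simp_all
        · simp only [hv, if_false, ← Finset.sum_add_distrib]
          refine Finset.sum_congr rfl fun w _ => ?_
          have := key w
          rcases SignType.trichotomy (X w) with hX | hX | hX <;>
            rcases hQ' w with h | h | h <;> simp_all
      by_cases hv : v ∈ H
      · have : Flip X a Q := by tauto
        have := hf.1 this
        simp only [hv, if_true] at hsum
        omega
      · have : ¬ Flip X a Q := by tauto
        have := mt hf.2 this
        simp only [hv, if_false] at hsum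
        omega
    · have := key w
      have := hc w
      rcases hQ' w with h | h | h <;> by_cases hf : Flip X a Q <;> by_cases hv : v ∈ H <;>
        simp_all [_root_.adopt]

end Greedy

namespace RAM

/-! ### Formulas as terms -/

namespace Tm

/-- A term, read as a formula, holds if its value is not `0`. -/
def Holds (t : Tm) (s : Memory) : Prop := t.eval s ≠ 0

/-- The contents of register `v`. -/
def var (v : ℕ) : Tm := .load v (.const 0)

/-- The contents of the cell of bank `k` whose address is in register `v`. -/
def cell (k v : ℕ) : Tm := .load k (var v)

def not (t : Tm) : Tm := .ite t (.const 0) (.const 1)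

def and (t u : Tm) : Tm := .ite t u (.const 0)

def or (t u : Tm) : Tm := .ite t (.const 1) u

def lt (t u : Tm) : Tm := .sub u t

def eq (t u : Tm) : Tm := not (.add (.sub t u) (.sub u t))

/-- The formula `t` holds for some value of register `v` below `n`. -/
def ex (v : ℕ) (t : Tm) : Tm := .sum v t

/-- The number of values of register `v` below `n` for which `t` holds. -/
def count (v : ℕ) (t : Tm) : Tm := .sum v (.ite t (.const 1) (.const 0))

@[simp] theorem eval_const (c : ℕ) (s : Memory) : (const c).eval s = c := rfl

@[simp] theorem eval_sub (t u : Tm) (s : Memory) : (sub t u).eval s = t.eval s - u.eval s := rfl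

@[simp] theorem eval_var (v : ℕ) (s : Memory) : (var v).eval s = s v 0 := rfl

@[simp] theorem eval_cell (k v : ℕ) (s : Memory) : (cell k v).eval s = s k (s v 0) := rfl

open Classical in
theorem eval_ite (c t u : Tm) (s : Memory) :
    (ite c t u).eval s = if c.Holds s then t.eval s else u.eval s := by
  simp only [eval, Holds]
  congr

@[simp] theorem holds_cell (k v : ℕ) (s : Memory) : (cell k v).Holds s ↔ s k (s v 0) ≠ 0 := Iff.rfl

@[simp] theorem holds_not (t : Tm) (s : Memory) : t.not.Holds s ↔ ¬ t.Holds s := by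
  simp [Holds, not, eval]

@[simp] theorem holds_and (t u : Tm) (s : Memory) :
    (t.and u).Holds s ↔ t.Holds s ∧ u.Holds s := by
  simp [Holds, and, eval]

@[simp] theorem holds_or (t u : Tm) (s : Memory) :
    (t.or u).Holds s ↔ t.Holds s ∨ u.Holds s := by
  simp only [Holds, or, eval]
  split_ifs with h <;> simp [h]

@[simp] theorem holds_lt (t u : Tm) (s : Memory) :
    (t.lt u).Holds s ↔ t.eval s < u.eval s := by
  simp only [Holds, lt, eval]
  omega

@[simp] theorem holds_eq (t u : Tm) (s : Memory) :
    (t.eq u).Holds s ↔ t.eval s = u.eval s := by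
  rw [eq, holds_not]
  simp only [Holds, eval]
  omega

theorem holds_ex {n : ℕ} {s : Memory} (hn : s 0 0 = n) (v : ℕ) (t : Tm) :
    (ex v t).Holds s ↔ ∃ i : Fin n, t.Holds (write s v 0 i) := by
  simp [Holds, ex, eval, hn, Fin.exists_iff]

theorem eval_count {n : ℕ} {s : Memory} (hn : s 0 0 = n) {v : ℕ} {t : Tm} {P : Fin n → Prop}
    [DecidablePred P] (h : ∀ i : Fin n, t.Holds (write s v 0 i) ↔ P i) :
    (count v t).eval s = Finset.card {i | P i} := by
  classical
  rw [Finset.card_filter, count, eval, hn, Finset.sum_range]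
  refine Finset.sum_congr rfl fun i _ => ?_
  simp only [eval_ite, eval_const, h]

end Tm

/-! ### The graph in memory -/

variable {n : ℕ} {G : SimpleGraph (Fin n)} {X : Fin n → SignType}

/-- The input is still in memory. -/
structure HasInput (G : SimpleGraph (Fin n)) (X : Fin n → SignType) (s : Memory) : Prop where
  size : s 0 0 = n
  adj : s 1 = inputMemory G X 1
  label : s 2 = inputMemory G X 2

theorem hasInput_inputMemory : HasInput G X (inputMemory G X) := ⟨rfl, rfl, rfl⟩

theorem HasInput.congr {s s' : Memory} (h : HasInput G X s) (h' : ∀ k < 3, s' k = s k) :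
    HasInput G X s' :=
  ⟨by rw [h' 0 (by omega), h.size], by rw [h' 1 (by omega), h.adj],
    by rw [h' 2 (by omega), h.label]⟩

theorem HasInput.write {s : Memory} (h : HasInput G X s) {k : ℕ} (hk : 3 ≤ k) (i x : ℕ) :
    HasInput G X (write s k i x) :=
  h.congr fun j hj => write_of_ne _ _ _ (by omega)

theorem HasInput.label_eq_one {s : Memory} (h : HasInput G X s) (v : Fin n) :
    s 2 v = 1 ↔ X v = 1 := by
  rw [h.label]
  simp only [inputMemory, v.isLt, dif_pos]
  rcases SignType.trichotomy (X v) with h | h | h <;> rw [h] <;> decide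

theorem HasInput.label_eq_two {s : Memory} (h : HasInput G X s) (v : Fin n) :
    s 2 v = 2 ↔ X v = -1 := by
  rw [h.label]
  simp only [inputMemory, v.isLt, dif_pos]
  rcases SignType.trichotomy (X v) with h | h | h <;> rw [h] <;> decide

namespace Tm

/-- The vertices in registers `x` and `y` are adjacent. The row offset is `n` times the number of
the row, i.e. this number summed over all values of register `99`. -/
def adj (x y : ℕ) : Tm := .load 1 (.add (.sum 99 (var x)) (var y))

/-- The formula for `CutEdge.Private`. The arguments of this and the following formulas are the
registers that hold `a`, `b`, the counts and the vertices in question. -/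
def isPrivate (a b c : ℕ) : Tm := and (adj a c) (and (not (eq (var c) (var b))) (not (adj b c)))

/-- The formula for `CutEdge.Common`. -/
def isCommon (a b c : ℕ) : Tm := and (adj a c) (adj b c)

/-- The formula for `CutEdge.Far`. -/
def isFar (a b c : ℕ) : Tm :=
  and (not (eq (var c) (var a))) (and (not (eq (var c) (var b)))
    (and (not (adj a c)) (not (adj b c))))

/-- The formula for `CutEdge.Border`; it binds register `40`. -/
def isBorder (a b k c : ℕ) : Tm :=
  or (lt (var k) (count 40 (and (isCommon a b 40) (adj c 40))))
    (ex 40 (and (isPrivate b a 40) (adj c 40)))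

/-- The formula for `CutEdge.Forced`; it binds registers `40` and `41`. -/
def isForced (a b k l w : ℕ) : Tm :=
  or (isPrivate a b w) (and (isCommon a b w) (ex 41
    (or (and (isPrivate a b 41) (and (not (isBorder a b k 41)) (adj 41 w)))
      (and (isPrivate b a 41) (and (isBorder b a l 41) (not (adj 41 w)))))))

/-- The formula for `CutEdge.Same`. -/
def isSame (a b k l u w : ℕ) : Tm :=
  or (and (adj u w) (or (isFar a b u) (isFar a b w)))
    (or (and (eq (var u) (var a)) (isForced a b k l w))
      (and (eq (var w) (var a)) (isForced a b k l u)))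

/-- The formula for `CutEdge.Diff`. -/
def isDiff (a b k l u w : ℕ) : Tm :=
  or (and (isCommon a b u) (and (isCommon a b w) (and (not (eq (var u) (var w)))
      (not (adj u w)))))
    (or (and (eq (var u) (var a)) (or (eq (var w) (var b)) (isForced b a l k w)))
      (and (eq (var w) (var a)) (or (eq (var u) (var b)) (isForced b a l k u))))

variable {s : Memory} {a b c u w : Fin n}

theorem holds_adj (h : HasInput G X s) {x y : ℕ} (hx : s x 0 = u) (hy : s y 0 = w)
    (hx' : x < 99 := by omega) : (adj x y).Holds s ↔ G.Adj u w := by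
  classical
  have hsum : ∑ i ∈ Finset.range n, write s 99 0 i x 0 = n * u := by
    rw [Finset.sum_congr rfl (g := fun _ => (u : ℕ))]
    · simp
    · intro i _
      rw [write_of_ne _ _ _ (by omega), hx]
  simp only [Holds, adj, eval, var, h.size, hsum, hy, h.adj, inputMemory]
  rw [ne_eq, ite_eq_right_iff, Classical.not_imp]
  simp only [one_ne_zero, not_false_eq_true, and_true]
  constructor
  · rintro ⟨i, j, hij, he⟩
    have hn : 0 < n := i.pos
    have h₁ := congrArg (· / n) he
    have h₂ := congrArg (· % n) he
    simp only [Nat.mul_comm (i : ℕ) n, Nat.mul_add_div hn, Nat.mul_add_mod, Nat.mod_eq_of_lt w.isLt,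
      Nat.mod_eq_of_lt j.isLt, Nat.div_eq_of_lt w.isLt, Nat.div_eq_of_lt j.isLt, add_zero] at h₁ h₂
    rwa [Fin.ext h₁, Fin.ext h₂]
  · exact fun huw => ⟨u, w, huw, by rw [Nat.mul_comm]⟩

variable {x y z k l : ℕ}

theorem holds_eq_var (hx : s x 0 = u) (hy : s y 0 = w) : (eq (var x) (var y)).Holds s ↔ u = w := by
  simp [hx, hy, Fin.ext_iff]

theorem holds_isPrivate (h : HasInput G X s) (hx : s x 0 = a) (hy : s y 0 = b) (hz : s z 0 = c)
    (hx' : x < 99 := by omega) (hy' : y < 99 := by omega) :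
    (isPrivate x y z).Holds s ↔ CutEdge.Private G a b c := by
  simp only [isPrivate, holds_and, holds_not, holds_adj h hx hz, holds_adj h hy hz,
    holds_eq_var hz hy, CutEdge.Private, ne_eq]

theorem holds_isCommon (h : HasInput G X s) (hx : s x 0 = a) (hy : s y 0 = b) (hz : s z 0 = c)
    (hx' : x < 99 := by omega) (hy' : y < 99 := by omega) :
    (isCommon x y z).Holds s ↔ CutEdge.Common G a b c := by
  simp only [isCommon, holds_and, holds_adj h hx hz, holds_adj h hy hz, CutEdge.Common]

theorem holds_isFar (h : HasInput G X s) (hx : s x 0 = a) (hy : s y 0 = b) (hz : s z 0 = c)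
    (hx' : x < 99 := by omega) (hy' : y < 99 := by omega) :
    (isFar x y z).Holds s ↔ CutEdge.Far G a b c := by
  simp only [isFar, holds_and, holds_not, holds_adj h hx hz, holds_adj h hy hz,
    holds_eq_var hz hx, holds_eq_var hz hy, CutEdge.Far, ne_eq]

theorem write_reg_of_ne {i : ℕ} (s : Memory) (v : ℕ) (h : x ≠ v) :
    write s v 0 i x 0 = s x 0 := by
  rw [write_of_ne _ _ _ h]

theorem write_reg_self (s : Memory) (v i : ℕ) : write s v 0 i v 0 = i := by
  simp [write_apply]

theorem holds_isBorder (h : HasInput G X s) (hx : s x 0 = a) (hy : s y 0 = b) (hz : s z 0 = c)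
    (hx' : x < 40 := by omega) (hy' : y < 40 := by omega) (hz' : z ≠ 40 := by omega)
    (hz'' : z < 99 := by omega) :
    (isBorder x y k z).Holds s ↔ CutEdge.Border G a b (s k 0) c := by
  classical
  have hw : ∀ d : Fin n, HasInput G X (write s 40 0 d) ∧ write s 40 0 d x 0 = a ∧
      write s 40 0 d y 0 = b ∧ write s 40 0 d z 0 = c ∧ write s 40 0 d 40 0 = d := fun d =>
    ⟨h.write (by omega) _ _, by rw [write_reg_of_ne _ _ (by omega), hx],
      by rw [write_reg_of_ne _ _ (by omega), hy], by rw [write_reg_of_ne _ _ hz', hz],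
      write_reg_self _ _ _⟩
  have h₁ : ∀ d : Fin n, (and (isCommon x y 40) (adj z 40)).Holds (write s 40 0 d) ↔
      CutEdge.Common G a b d ∧ G.Adj c d := fun d => by
    obtain ⟨hI, ha, hb, hc, hd⟩ := hw d
    rw [holds_and, holds_isCommon hI ha hb hd, holds_adj hI hc hd]
  have h₂ : ∀ d : Fin n, (and (isPrivate y x 40) (adj z 40)).Holds (write s 40 0 d) ↔
      CutEdge.Private G b a d ∧ G.Adj c d := fun d => by
    obtain ⟨hI, ha, hb, hc, hd⟩ := hw d
    rw [holds_and, holds_isPrivate hI hb ha hd, holds_adj hI hc hd]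
  rw [isBorder, holds_or, holds_lt, eval_var, eval_count h.size h₁, holds_ex h.size,
    CutEdge.Border]
  simp only [h₂]

theorem holds_isForced (h : HasInput G X s) (hx : s x 0 = a) (hy : s y 0 = b) (hz : s z 0 = c)
    (hx' : x < 40 := by omega) (hy' : y < 40 := by omega) (hk : k < 40 := by omega)
    (hl : l < 40 := by omega) (hz' : z ≠ 41 := by omega) :
    (isForced x y k l z).Holds s ↔ CutEdge.Forced G a b (s k 0) (s l 0) c := by
  have hw : ∀ d : Fin n, (or (and (isPrivate x y 41) (and (not (isBorder x y k 41)) (adj 41 z)))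
      (and (isPrivate y x 41) (and (isBorder y x l 41) (not (adj 41 z))))).Holds (write s 41 0 d) ↔
      (CutEdge.Private G a b d ∧ ¬ CutEdge.Border G a b (s k 0) d ∧ G.Adj d c ∨
        CutEdge.Private G b a d ∧ CutEdge.Border G b a (s l 0) d ∧ ¬ G.Adj d c) := fun d => by
    have hI : HasInput G X (write s 41 0 d) := h.write (by omega) _ _
    have ha : write s 41 0 d x 0 = a := by rw [write_reg_of_ne _ _ (by omega), hx]
    have hb : write s 41 0 d y 0 = b := by rw [write_reg_of_ne _ _ (by omega), hy]
    have hc : write s 41 0 d z 0 = c := by rw [write_reg_of_ne _ _ (by omega), hz]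
    have hd : write s 41 0 d 41 0 = d := write_reg_self _ _ _
    rw [holds_or, holds_and, holds_and, holds_and, holds_and, holds_not, holds_not,
      holds_isPrivate hI ha hb hd, holds_isPrivate hI hb ha hd, holds_isBorder hI ha hb hd,
      holds_isBorder hI hb ha hd, holds_adj hI hd hc, write_reg_of_ne _ _ (by omega : k ≠ 41),
      write_reg_of_ne _ _ (by omega : l ≠ 41)]
  simp only [isForced, holds_or, holds_and, holds_isPrivate h hx hy hz, holds_isCommon h hx hy hz,
    holds_ex h.size, hw, CutEdge.Forced]

theorem holds_isSame (h : HasInput G X s) (hx : s x 0 = a) (hy : s y 0 = b) {u' w' : ℕ}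
    (hu : s u' 0 = u) (hw : s w' 0 = w) (hx' : x < 40 := by omega) (hy' : y < 40 := by omega)
    (hk : k < 40 := by omega) (hl : l < 40 := by omega) (hu' : u' ≠ 41 := by omega)
    (hw' : w' ≠ 41 := by omega) (hu'' : u' < 99 := by omega) :
    (isSame x y k l u' w').Holds s ↔ CutEdge.Same G a b (s k 0) (s l 0) u w := by
  simp only [isSame, holds_or, holds_and, holds_adj h hu hw, holds_isFar h hx hy hu,
    holds_isFar h hx hy hw, holds_eq_var hu hx, holds_eq_var hw hx, holds_isForced (k := k) (l := l) h hx hy hu,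
    holds_isForced (k := k) (l := l) h hx hy hw, CutEdge.Same]

theorem holds_isDiff (h : HasInput G X s) (hx : s x 0 = a) (hy : s y 0 = b) {u' w' : ℕ}
    (hu : s u' 0 = u) (hw : s w' 0 = w) (hx' : x < 40 := by omega) (hy' : y < 40 := by omega)
    (hk : k < 40 := by omega) (hl : l < 40 := by omega) (hu' : u' ≠ 41 := by omega)
    (hw' : w' ≠ 41 := by omega) (hu'' : u' < 99 := by omega) :
    (isDiff x y k l u' w').Holds s ↔ CutEdge.Diff G a b (s k 0) (s l 0) u w := by
  simp only [isDiff, holds_or, holds_and, holds_not, holds_adj h hu hw, holds_isCommon h hx hy hu,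
    holds_isCommon h hx hy hw, holds_eq_var hu hx, holds_eq_var hw hx, holds_eq_var hu hy,
    holds_eq_var hw hy, holds_eq_var hu hw, holds_isForced (k := l) (l := k) h hy hx hu,
    holds_isForced (k := l) (l := k) h hy hx hw, CutEdge.Diff, ne_eq]

end Tm

end RAM

namespace RAM

/-! ### The algorithm -/

/-!
The banks in use are: `3` the incumbent, `4` its number of errors, `5` the candidate, `10` the
values propagated from one vertex, `11` the partial assignment, `20` to `23` the guess `a`, `b`,
`k`, `l`, `24` and `25` loop counters, and from `40` on the registers bound by terms.
-/

open Tm St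

/-- One round of propagation in bank `10` for the vertex in register `43`. -/
def propagateTm : Tm :=
  .ite (cell 10 43) (cell 10 43)
    (.ite (ex 42 (or (and (eq (cell 10 42) (.const 2)) (isSame 20 21 22 23 42 43))
        (and (eq (cell 10 42) (.const 1)) (isDiff 20 21 22 23 42 43)))) (.const 2)
      (.ite (ex 42 (or (and (eq (cell 10 42) (.const 1)) (isSame 20 21 22 23 42 43))
        (and (eq (cell 10 42) (.const 2)) (isDiff 20 21 22 23 42 43)))) (.const 1)
        (.const 0)))

/-- The number of vertices with label `1` and value `i` in bank `10`, or label `-1` and value `j`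
in bank `10`. -/
def componentErrors (i j : ℕ) : Tm :=
  count 44 (or (and (eq (cell 2 44) (.const 1)) (eq (cell 10 44) (.const i)))
    (and (eq (cell 2 44) (.const 2)) (eq (cell 10 44) (.const j))))

/-- `Flip` for the vertex in register `20` and the propagated values in bank `10`. -/
def isFlip : Tm :=
  or (eq (cell 10 20) (.const 1)) (and (eq (cell 10 20) (.const 0))
    (lt (componentErrors 2 1) (componentErrors 1 2)))

/-- Propagate from the vertex in register `24`; the result is in bank `10`. -/
def propagateSt : St :=
  .seq (.fill 10 43 (.ite (eq (var 43) (var 24)) (.const 2) (.const 0)))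
    (.loop 25 (.fill 10 43 propagateTm))

/-- Adopt the better choice for the known part in bank `10` into the partial assignment in
bank `11`. -/
def adoptSt : St :=
  .fill 11 43 (.ite (cell 10 43)
    (.ite isFlip (.sub (.const 3) (cell 10 43)) (cell 10 43)) (cell 11 43))

/-- Compute the assignment in bank `11` for the cut edge in registers `20`, `21` and the counts in
registers `22`, `23`. -/
def greedySt : St :=
  .seq (.fill 11 43 (.const 0))
    (.loop 24 (.when (not (cell 11 24)) (.seq propagateSt adoptSt)))

/-- The candidate in bank `5` has clique borders. -/
def hasCliqueBorders : Tm :=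
  not (ex 45 (ex 46 (ex 47 (ex 48 (and (adj 45 46) (and (adj 47 48) (and (cell 5 45)
    (and (not (cell 5 46)) (and (cell 5 47) (and (not (cell 5 48))
      (not (and (or (eq (var 45) (var 47)) (adj 45 47))
        (or (eq (var 46) (var 48)) (adj 46 48))))))))))))))

/-- The number of errors of the candidate in bank `5`. -/
def candidateErrors : Tm :=
  count 44 (or (and (eq (cell 2 44) (.const 1)) (not (cell 5 44)))
    (and (eq (cell 2 44) (.const 2)) (cell 5 44)))

/-- Replace the incumbent in bank `3`, whose number of errors is in register `4`, by the candidate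
in bank `5` if the latter is a halfspace with fewer errors. -/
def improveSt : St :=
  .when (and hasCliqueBorders (lt candidateErrors (var 4)))
    (.seq (.set 4 candidateErrors) (.fill 3 43 (cell 5 43)))

/-- Try the candidate for the guess in registers `20` to `23`. -/
def guessSt : St :=
  .seq greedySt (.seq (.fill 5 43 (eq (cell 11 43) (.const 2))) improveSt)

/-- Try all guesses. -/
def searchSt : St := .loop 20 (.loop 21 (.loop 22 (.loop 23 guessSt)))

/-- The whole algorithm. The bound `n + 1` for the number of errors makes the first candidate, the
empty set, the first incumbent. -/
def ermSt : St :=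
  .seq (.set 4 (.add (var 0) (.const 1))) (.seq (.fill 5 43 (.const 0)) (.seq improveSt
    (.seq (.fill 5 43 (.const 1)) (.seq improveSt searchSt))))

theorem ermSt_ok : ermSt.ok 100 := by decide

theorem sem_fill_same (k v : ℕ) (e : Tm) {n : ℕ} {s : Memory} (hn : s 0 0 = n) (x : Fin n) :
    (St.fill k v e).sem s k x = e.eval (write s v 0 x) := by
  simp [sem, hn]

theorem sem_fill_of_ne {k k' : ℕ} (v : ℕ) (e : Tm) (s : Memory) (h : k' ≠ k) :
    (St.fill k v e).sem s k' = s k' := by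
  simp [sem, h]

theorem sem_loop (v : ℕ) (p : St) {n : ℕ} {s : Memory} (hn : s 0 0 = n) :
    (St.loop v p).sem s = iter p.sem v s n := by
  rw [← hn, sem]

theorem iter_counter (f : Memory → Memory) (v : ℕ) (s : Memory) (i : ℕ) :
    iter f v s i v 0 = i := by
  cases i <;> simp [iter, write_apply]

theorem iter_induction {f : Memory → Memory} {v : ℕ} {s : Memory} (n : ℕ) (I : ℕ → Memory → Prop)
    (h0 : I 0 (write s v 0 0))
    (hstep : ∀ i < n, ∀ s', I i s' → s' v 0 = i → I (i + 1) (write (f s') v 0 (i + 1))) :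
    I n (iter f v s n) := by
  have : ∀ i ≤ n, I i (iter f v s i) := by
    intro i
    induction i with
    | zero => exact fun _ => h0
    | succ i ih => exact fun hi => hstep i hi _ (ih (by omega)) (iter_counter f v s i)
  exact this n le_rfl

variable {n : ℕ} {G : SimpleGraph (Fin n)} {X : Fin n → SignType} {s : Memory}

/-! ### Correctness of the candidates -/

/-- The cells of bank `k` that belong to vertices. -/
def bank (n : ℕ) (s : Memory) (k : ℕ) (v : Fin n) : ℕ := s k v

/-- The guess is in memory. -/
structure HasGuess (a b : Fin n) (k l : ℕ) (s : Memory) : Prop where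
  fst : s 20 0 = a
  snd : s 21 0 = b
  inside : s 22 0 = k
  outside : s 23 0 = l

theorem HasGuess.congr {a b : Fin n} {k l : ℕ} {s s' : Memory} (h : HasGuess a b k l s)
    (h' : ∀ j, 20 ≤ j → j < 24 → s' j = s j) : HasGuess a b k l s' :=
  ⟨by rw [h' 20 (by omega) (by omega), h.fst], by rw [h' 21 (by omega) (by omega), h.snd],
    by rw [h' 22 (by omega) (by omega), h.inside], by rw [h' 23 (by omega) (by omega), h.outside]⟩

theorem HasGuess.write {a b : Fin n} {k l : ℕ} {s : Memory} (h : HasGuess a b k l s) {j : ℕ}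
    (hj : 24 ≤ j ∨ j < 20) (i x : ℕ) : HasGuess a b k l (write s j i x) :=
  h.congr fun _ _ _ => write_of_ne _ _ _ (by omega)

variable {a b : Fin n} {k l : ℕ}

theorem eval_propagateTm (h : HasInput G X s) (hg : HasGuess a b k l s) (w : Fin n) :
    propagateTm.eval (write s 43 0 w) =
      propagate (CutEdge.Same G a b k l) (CutEdge.Diff G a b k l) (bank n s 10) w := by
  classical
  have hI : HasInput G X (write s 43 0 w) := h.write (by omega) _ _
  have hI' : ∀ u : Fin n, HasInput G X (write (write s 43 0 w) 42 0 u) := fun u =>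
    hI.write (by omega) _ _
  have hg' : ∀ u : Fin n, HasGuess a b k l (write (write s 43 0 w) 42 0 u) := fun u =>
    (hg.write (by omega) _ _).write (by omega) _ _
  have hs : ∀ u : Fin n, (isSame 20 21 22 23 42 43).Holds (write (write s 43 0 w) 42 0 u) ↔
      CutEdge.Same G a b k l u w := fun u => by
    rw [holds_isSame (hI' u) (hg' u).fst (hg' u).snd (u := u) (w := w) (by simp [write_apply])
      (by simp [write_apply]), (hg' u).inside, (hg' u).outside]
  have hd : ∀ u : Fin n, (isDiff 20 21 22 23 42 43).Holds (write (write s 43 0 w) 42 0 u) ↔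
      CutEdge.Diff G a b k l u w := fun u => by
    rw [holds_isDiff (hI' u) (hg' u).fst (hg' u).snd (u := u) (w := w) (by simp [write_apply])
      (by simp [write_apply]), (hg' u).inside, (hg' u).outside]
  simp only [propagateTm, eval_ite, holds_ex hI.size, holds_or, holds_and, holds_eq, hs, hd,
    holds_cell, eval_cell, eval_const, propagate, bank]
  by_cases h0 : s 10 w = 0
  · simp [write_apply, h0]
    congr
  · simp [write_apply, h0]

/-- Propagation from `v` leaves values that are correct for every feasible set, and that are known
for a union of components. -/
theorem propagateSt_spec (h : HasInput G X s) (hg : HasGuess a b k l s) {v : Fin n}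
    (hv : s 24 0 = v) {H : Set (Fin n)}
    (hH : Feasible (CutEdge.Same G a b k l) (CutEdge.Diff G a b k l) a H) :
    Agrees v H (bank n (propagateSt.sem s) 10) ∧
      Closed (CutEdge.Same G a b k l) (CutEdge.Diff G a b k l)
        (bank n (propagateSt.sem s) 10) := by
  classical
  set E := CutEdge.Same G a b k l
  set D := CutEdge.Diff G a b k l
  set s₁ := (St.fill 10 43 (.ite (eq (var 43) (var 24)) (.const 2) (.const 0))).sem s with hs₁
  have h₁ : HasInput G X s₁ := h.congr fun j hj => sem_fill_of_ne _ _ _ (by omega)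
  have hg₁ : HasGuess a b k l s₁ := hg.congr fun j _ _ => sem_fill_of_ne _ _ _ (by omega)
  have hQ : ∀ w : Fin n, bank n s₁ 10 w = if w = v then 2 else 0 := by
    intro w
    rw [bank, hs₁, sem_fill_same _ _ _ h.size, eval_ite]
    simp [write_apply, hv, Fin.ext_iff]
  have hmain := iter_induction (f := (St.fill 10 43 propagateTm).sem) (v := 25) (s := s₁) n
    (fun i s' => HasInput G X s' ∧ HasGuess a b k l s' ∧ Agrees v H (bank n s' 10) ∧
      (Closed E D (bank n s' 10) ∨ i + 1 ≤ Finset.card {w | bank n s' 10 w ≠ 0})) ?_ ?_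
  · obtain ⟨-, -, hA, hC⟩ := hmain
    have hsem : propagateSt.sem s = iter (St.fill 10 43 propagateTm).sem 25 s₁ n :=
      sem_loop 25 _ h₁.size
    rw [hsem]
    -- after `n` rounds, more than `n` vertices would be known if the known part were not closed
    refine ⟨hA, hC.resolve_right fun hc => ?_⟩
    have := hc.trans (Finset.card_le_univ _)
    rw [Fintype.card_fin] at this
    omega
  · have hb : bank n (write s₁ 25 0 0) 10 = bank n s₁ 10 :=
      funext fun w => by rw [bank, write_of_ne _ _ _ (by omega), bank]
    refine ⟨h₁.write (by omega) _ _, hg₁.write (by omega) _ _, ?_, .inr ?_⟩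
    · rw [hb]
      constructor
      · simp [hQ]
      all_goals
        intro w
        rw [hQ]
        split_ifs with hw
      · omega
      · omega
      · simp [hw]
      · simp
      · simp
      · simp
    · rw [hb, Nat.succ_le_iff, Finset.card_pos]
      exact ⟨v, by simp [hQ]⟩
  · rintro i - s' ⟨hI, hG, hA, hC⟩ -
    have hb : bank n (write ((St.fill 10 43 propagateTm).sem s') 25 0 (i + 1)) 10 =
        propagate E D (bank n s' 10) := funext fun w => by
      rw [bank, write_of_ne _ _ _ (by omega), sem_fill_same _ _ _ hI.size,
        eval_propagateTm hI hG]
    rw [hb]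
    refine ⟨(hI.congr fun j hj => sem_fill_of_ne _ _ _ (by omega)).write (by omega) _ _,
      (hG.congr fun j _ _ => sem_fill_of_ne _ _ _ (by omega)).write (by omega) _ _,
      hA.propagate hH, closed_propagate_or hA.le_two hC⟩

theorem eval_componentErrors (h : HasInput G X s) :
    (componentErrors 1 2).eval s = keepErrors X (bank n s 10) ∧
      (componentErrors 2 1).eval s = flipErrors X (bank n s 10) := by
  classical
  have hw : ∀ (i j : ℕ) (w : Fin n), (or (and (eq (cell 2 44) (.const 1))
      (eq (cell 10 44) (.const i))) (and (eq (cell 2 44) (.const 2))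
      (eq (cell 10 44) (.const j)))).Holds (write s 44 0 w) ↔
      (X w = 1 ∧ bank n s 10 w = i ∨ X w = -1 ∧ bank n s 10 w = j) := by
    intro i j w
    simp only [holds_or, holds_and, holds_eq, eval_cell, eval_const, write_reg_self,
      write_of_ne _ _ _ (by omega : 2 ≠ 44), write_of_ne _ _ _ (by omega : 10 ≠ 44),
      h.label_eq_one, h.label_eq_two, bank]
  exact ⟨eval_count h.size (hw 1 2), eval_count h.size (hw 2 1)⟩

theorem holds_isFlip (h : HasInput G X s) (ha : s 20 0 = a) :
    isFlip.Holds s ↔ Flip X a (bank n s 10) := by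
  obtain ⟨h₁, h₂⟩ := eval_componentErrors h
  simp only [isFlip, holds_or, holds_and, holds_eq, holds_lt, eval_cell, eval_const, h₁, h₂, ha,
    Flip, bank]

theorem bank_adoptSt (h : HasInput G X s) (ha : s 20 0 = a) :
    bank n (adoptSt.sem s) 11 = adopt X a (bank n s 10) (bank n s 11) := by
  classical
  funext w
  rw [bank, adoptSt, sem_fill_same _ _ _ h.size]
  have hb : bank n (write s 43 0 w) 10 = bank n s 10 :=
    funext fun u => by rw [bank, write_of_ne _ _ _ (by omega), bank]
  have hf := holds_isFlip (X := X) (h.write (by omega : 3 ≤ 43) 0 w) (a := a)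
    (by rw [write_reg_of_ne _ _ (by omega), ha])
  rw [hb] at hf
  simp only [eval_ite, holds_cell, hf, eval_cell, adopt, bank, eval_sub, eval_const, write_reg_self,
    write_of_ne _ _ _ (by omega : 10 ≠ 43), write_of_ne _ _ _ (by omega : 11 ≠ 43), ne_eq]
  congr

/-- If the guess is right for `H`, i.e. `H` is feasible, then the assignment in bank `11` is the
indicator of a feasible set that is not worse than `H`. -/
theorem greedySt_spec (h : HasInput G X s) (hg : HasGuess a b k l s) {H : Set (Fin n)}
    (hH : Feasible (CutEdge.Same G a b k l) (CutEdge.Diff G a b k l) a H) :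
    ∃ H', Feasible (CutEdge.Same G a b k l) (CutEdge.Diff G a b k l) a H' ∧
      errors X H' ≤ errors X H ∧ ∀ w : Fin n, greedySt.sem s 11 w = 2 ↔ w ∈ H' := by
  classical
  set E := CutEdge.Same G a b k l
  set D := CutEdge.Diff G a b k l
  set s₁ := (St.fill 11 43 (.const 0)).sem s with hs₁
  have h₁ : HasInput G X s₁ := h.congr fun j hj => sem_fill_of_ne _ _ _ (by omega)
  have hg₁ : HasGuess a b k l s₁ := hg.congr fun j _ _ => sem_fill_of_ne _ _ _ (by omega)
  -- at every stage, some feasible set that is not worse than `H` extends the partial assignment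
  have hmain := iter_induction
    (f := (St.when (not (cell 11 24)) (.seq propagateSt adoptSt)).sem) (v := 24) (s := s₁) n
    (fun i s' => HasInput G X s' ∧ HasGuess a b k l s' ∧ (∀ w, bank n s' 11 w ≤ 2) ∧
      (∀ w : Fin n, (w : ℕ) < i → bank n s' 11 w ≠ 0) ∧
      ∃ H', Feasible E D a H' ∧ errors X H' ≤ errors X H ∧ Extends H' (bank n s' 11)) ?_ ?_
  · obtain ⟨-, -, hle, hall, H', hF, herr, hext⟩ := hmain
    refine ⟨H', hF, herr, fun w => ?_⟩
    have hw : greedySt.sem s 11 w = bank n (iter (St.when (not (cell 11 24))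
        (.seq propagateSt adoptSt)).sem 24 s₁ n) 11 w :=
      congrFun (congrFun (sem_loop 24 _ h₁.size) 11) w
    have h₂ := hle w
    have h₃ := hall w w.isLt
    have h₄ := hext w
    rw [hw]
    constructor
    · exact h₄.1
    · intro hwH
      by_contra hne
      exact h₄.2 (by omega) hwH
  · have hb : bank n (write s₁ 24 0 0) 11 = fun _ => 0 := funext fun w => by
      rw [bank, write_of_ne _ _ _ (by omega), hs₁, sem_fill_same _ _ _ h.size, eval_const]
    rw [hb]
    exact ⟨h₁.write (by omega) _ _, hg₁.write (by omega) _ _, by simp, by simp, H, hH, le_rfl,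
      by simp [Extends]⟩
  · rintro i hi s' ⟨hI, hG, hle, hall, H', hF, herr, hext⟩ hv
    have hb : ∀ s'' : Memory, bank n (write s'' 24 0 (i + 1)) 11 = bank n s'' 11 := fun s'' =>
      funext fun w => by rw [bank, write_of_ne _ _ _ (by omega), bank]
    rw [hb]
    by_cases hc : s' 11 i = 0
    · set s₂ := propagateSt.sem s' with hs₂
      have hw₂ : ∀ j, j ∉ propagateSt.writes → s₂ j = s' j := fun j hj =>
        sem_of_notMem_writes hj s'
      have hmem : ∀ j, j ∈ propagateSt.writes → j = 10 ∨ j = 25 := by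
        simp [propagateSt, writes]
      have hlow : ∀ j, j ≠ 10 → j ≠ 25 → s₂ j = s' j := fun j h₁ h₂ =>
        hw₂ j fun hj => (hmem j hj).elim h₁ h₂
      have hI₂ : HasInput G X s₂ := hI.congr fun j hj => hlow j (by omega) (by omega)
      have hG₂ : HasGuess a b k l s₂ := hG.congr fun j _ _ => hlow j (by omega) (by omega)
      have hsem : (St.when (not (cell 11 24)) (.seq propagateSt adoptSt)).sem s' =
          adoptSt.sem s₂ := by
        have : (not (cell 11 24)).Holds s' := by simp [hv, hc]
        exact if_pos this
      have hadopt : bank n (adoptSt.sem s₂) 11 = adopt X a (bank n s₂ 10) (bank n s' 11) := by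
        rw [bank_adoptSt hI₂ hG₂.fst]
        congr 1
        exact funext fun w => by rw [bank, hlow 11 (by omega) (by omega), bank]
      have hlow₃ : ∀ j, j ≠ 11 → adoptSt.sem s₂ j = s₂ j := fun j hj =>
        sem_fill_of_ne _ _ _ hj
      obtain ⟨hA, hC⟩ := propagateSt_spec hI hG (v := ⟨i, hi⟩) hv hF
      obtain ⟨H'', hF', herr', hext'⟩ := hF.adopt X (fun _ _ => CutEdge.Same.symm)
        (fun _ _ => CutEdge.Diff.symm) hC hA hext
      rw [hsem, hadopt]
      have hQ : ∀ w, bank n s₂ 10 w ≤ 2 := hA.le_two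
      refine ⟨(hI₂.congr fun j hj => hlow₃ j (by omega)).write (by omega) _ _,
        (hG₂.congr fun j _ _ => hlow₃ j (by omega)).write (by omega) _ _, fun w => ?_,
        fun w hw => ?_, H'', hF', herr'.trans herr, hext'⟩
      · have h₁ := hQ w
        have h₂ := hle w
        unfold adopt
        split_ifs <;> omega
      · have h₁ := hQ w
        by_cases hwi : (w : ℕ) = i
        · have h₂ : bank n s₂ 10 w = 2 := by
            rw [← hA.start]
            congr 1
            exact Fin.ext hwi
          unfold adopt
          split_ifs <;> omega
        · have h₂ := hall w (by omega)
          unfold adopt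
          split_ifs <;> omega
    · have hsem : (St.when (not (cell 11 24)) (.seq propagateSt adoptSt)).sem s' = s' := by
        have : ¬ (not (cell 11 24)).Holds s' := by simp [hv, hc]
        exact if_neg this
      rw [hsem]
      refine ⟨hI.write (by omega) _ _, hG.write (by omega) _ _, hle, fun w hw => ?_, H', hF, herr,
        hext⟩
      by_cases hwi : (w : ℕ) = i
      · rwa [bank, hwi]
      · exact hall w (by omega)

/-! ### The incumbent -/

/-- The vertex set whose indicator vector is in bank `k`. -/
def setIn (n : ℕ) (s : Memory) (k : ℕ) : Set (Fin n) := {v | s k v ≠ 0}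

theorem eval_candidateErrors (h : HasInput G X s) :
    candidateErrors.eval s = errors X (setIn n s 5) := by
  classical
  refine eval_count h.size fun w => ?_
  simp only [holds_or, holds_and, holds_eq, holds_not, holds_cell, eval_cell, eval_const,
    write_reg_self, write_of_ne _ _ _ (by omega : 2 ≠ 44), write_of_ne _ _ _ (by omega : 5 ≠ 44),
    h.label_eq_one, h.label_eq_two, setIn, Set.mem_ofPred_eq]

theorem holds_hasCliqueBorders (h : HasInput G X s) :
    hasCliqueBorders.Holds s ↔ CliqueBorders G (setIn n s 5) := by
  have hw : ∀ a b c d : Fin n, ∀ s', s' = write (write (write (write s 45 0 a) 46 0 b) 47 0 c)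
      48 0 d → HasInput G X s' ∧ s' 45 0 = a ∧ s' 46 0 = b ∧ s' 47 0 = c ∧ s' 48 0 = d ∧
        s' 5 = s 5 := by
    rintro a b c d _ rfl
    refine ⟨(((h.write ?_ _ _).write ?_ _ _).write ?_ _ _).write ?_ _ _, ?_, ?_, ?_, ?_, ?_⟩
    any_goals omega
    any_goals simp [write_apply]
    iterate 4 rw [write_of_ne _ _ _ (by omega)]
  rw [hasCliqueBorders, holds_not, holds_ex h.size]
  rw [exists_congr fun a => holds_ex (n := n) (by rw [write_of_ne _ _ _ (by omega), h.size]) _ _]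
  rw [exists_congr fun a => exists_congr fun b => holds_ex (n := n) (by
    iterate 2 rw [write_of_ne _ _ _ (by omega)]
    exact h.size) _ _]
  rw [exists_congr fun a => exists_congr fun b => exists_congr fun c => holds_ex (n := n) (by
    iterate 3 rw [write_of_ne _ _ _ (by omega)]
    exact h.size) _ _]
  push Not
  refine forall_congr' fun a => forall_congr' fun b => forall_congr' fun c => forall_congr' fun d =>
    ?_
  generalize hs' : write (write (write (write s 45 0 a) 46 0 b) 47 0 c) 48 0 d = s'
  obtain ⟨hI, ha, hb, hc, hd, h5⟩ := hw a b c d s' hs'.symm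
  simp only [holds_and, holds_or, holds_not, holds_cell, holds_adj hI ha hb, holds_adj hI hc hd,
    holds_adj hI ha hc, holds_adj hI hb hd, holds_eq_var ha hc, holds_eq_var hb hd, ha, hb, hc, hd,
    h5, setIn, Set.mem_ofPred_eq]
  tauto

/-- The incumbent in bank `3` is a halfspace, and its number of errors is in register `4`. -/
structure Incumbent (G : SimpleGraph (Fin n)) (X : Fin n → SignType) (s : Memory) : Prop where
  input : HasInput G X s
  le_one : ∀ v : Fin n, s 3 v ≤ 1
  borders : CliqueBorders G (setIn n s 3)
  errors_eq : errors X (setIn n s 3) = s 4 0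

theorem Incumbent.congr {s' : Memory} (h : Incumbent G X s) (h' : ∀ k < 5, s' k = s k) :
    Incumbent G X s' := by
  have hset : setIn n s' 3 = setIn n s 3 := by rw [setIn, setIn, h' 3 (by omega)]
  exact ⟨h.input.congr fun k hk => h' k (by omega), by rw [h' 3 (by omega)]; exact h.le_one,
    hset ▸ h.borders, by rw [hset, h.errors_eq, h' 4 (by omega)]⟩

theorem improveSt_of_better (h : HasInput G X s) (h5 : ∀ v : Fin n, s 5 v ≤ 1)
    (hC : CliqueBorders G (setIn n s 5)) (hlt : errors X (setIn n s 5) < s 4 0) :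
    Incumbent G X (improveSt.sem s) ∧ improveSt.sem s 4 0 = errors X (setIn n s 5) := by
  have hsem : improveSt.sem s =
      (St.fill 3 43 (cell 5 43)).sem (write s 4 0 (errors X (setIn n s 5))) := by
    have : (and hasCliqueBorders (lt candidateErrors (var 4))).Holds s := by
      rw [holds_and, holds_hasCliqueBorders h, holds_lt, eval_candidateErrors h]
      exact ⟨hC, hlt⟩
    rw [← eval_candidateErrors h]
    exact if_pos this
  set s₁ := write s 4 0 (errors X (setIn n s 5)) with hs₁
  have h₁ : HasInput G X s₁ := h.write (by omega) _ _
  have h3 : ∀ v : Fin n, improveSt.sem s 3 v = s 5 v := fun v => by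
    rw [hsem, sem_fill_same _ _ _ h₁.size, eval_cell, write_reg_self, write_of_ne _ _ _ (by omega),
      hs₁, write_of_ne _ _ _ (by omega)]
  have hset : setIn n (improveSt.sem s) 3 = setIn n s 5 := by
    simp only [setIn, h3]
  have h4 : improveSt.sem s 4 0 = errors X (setIn n s 5) := by
    rw [hsem, sem_fill_of_ne _ _ _ (by omega), hs₁, write_reg_self]
  refine ⟨⟨?_, fun v => by rw [h3]; exact h5 v, hset ▸ hC, by rw [hset, h4]⟩, h4⟩
  exact hsem ▸ h₁.congr fun j hj => sem_fill_of_ne _ _ _ (by omega)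

theorem improveSt_of_not_better (h : HasInput G X s)
    (hC : ¬ (CliqueBorders G (setIn n s 5) ∧ errors X (setIn n s 5) < s 4 0)) :
    improveSt.sem s = s := by
  have : ¬ (and hasCliqueBorders (lt candidateErrors (var 4))).Holds s := by
    rw [holds_and, holds_hasCliqueBorders h, holds_lt, eval_candidateErrors h]
    exact hC
  exact if_neg this

theorem improveSt_spec (h : Incumbent G X s) (h5 : ∀ v : Fin n, s 5 v ≤ 1) :
    Incumbent G X (improveSt.sem s) ∧ improveSt.sem s 4 0 ≤ s 4 0 ∧
      (CliqueBorders G (setIn n s 5) → improveSt.sem s 4 0 ≤ errors X (setIn n s 5)) := by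
  by_cases hC : CliqueBorders G (setIn n s 5) ∧ errors X (setIn n s 5) < s 4 0
  · obtain ⟨h₁, h₂⟩ := improveSt_of_better h.input h5 hC.1 hC.2
    exact ⟨h₁, h₂ ▸ hC.2.le, fun _ => h₂.le⟩
  · rw [improveSt_of_not_better h.input hC]
    exact ⟨h, le_rfl, fun hB => by by_contra! hlt; exact hC ⟨hB, hlt⟩⟩

/-! ### The search -/

/-- The statement keeps up the incumbent and never increases its number of errors. -/
def Improves (G : SimpleGraph (Fin n)) (X : Fin n → SignType) (p : St) : Prop :=
  ∀ s, Incumbent G X s → Incumbent G X (p.sem s) ∧ p.sem s 4 0 ≤ s 4 0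

/-- Started with the registers as listed in `L`, the statement brings the number of errors of the
incumbent down to `m`. -/
def Reaches (G : SimpleGraph (Fin n)) (X : Fin n → SignType) (p : St) (L : List (ℕ × ℕ)) (m : ℕ) :
    Prop :=
  ∀ s, Incumbent G X s → (∀ q ∈ L, s q.1 0 = q.2) → p.sem s 4 0 ≤ m

theorem Incumbent.write (h : Incumbent G X s) {j : ℕ} (hj : 5 ≤ j) (i x : ℕ) :
    Incumbent G X (write s j i x) :=
  h.congr fun _ _ => write_of_ne _ _ _ (by omega)

theorem Improves.loop {p : St} (hp : Improves G X p) {v : ℕ} (hv : 5 ≤ v) :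
    Improves G X (.loop v p) := by
  intro s hs
  refine iter_induction (s 0 0) (fun _ s' => Incumbent G X s' ∧ s' 4 0 ≤ s 4 0)
    ⟨hs.write hv _ _, by rw [write_of_ne _ _ _ (by omega)]⟩ ?_
  rintro i - s' ⟨hI, hle⟩ -
  obtain ⟨h₁, h₂⟩ := hp s' hI
  exact ⟨h₁.write hv _ _, by rw [write_of_ne _ _ _ (by omega)]; exact h₂.trans hle⟩

theorem Reaches.loop {p : St} (hp : Improves G X p) {v : ℕ} (hv : 5 ≤ v) {i : ℕ} (hi : i < n)
    {L : List (ℕ × ℕ)} (hL : ∀ q ∈ L, q.1 ∉ (St.loop v p).writes) {m : ℕ}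
    (h : Reaches G X p ((v, i) :: L) m) : Reaches G X (.loop v p) L m := by
  intro s hs hsL
  have hmain := iter_induction (f := p.sem) (v := v) (s := s) (s 0 0)
    (fun j s' => Incumbent G X s' ∧ (∀ q ∈ L, s' q.1 0 = q.2) ∧ (i < j → s' 4 0 ≤ m))
    ⟨hs.write hv _ _, fun q hq => ?_, by simp⟩ ?_
  · exact hmain.2.2 (by rw [hs.input.size]; exact hi)
  · have := hL q hq
    simp only [writes, List.mem_cons, not_or] at this
    rw [write_of_ne _ _ _ this.1, hsL q hq]
  · rintro j - s' ⟨hI, hsL', hm⟩ hj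
    obtain ⟨h₁, h₂⟩ := hp s' hI
    refine ⟨h₁.write hv _ _, fun q hq => ?_, fun hij => ?_⟩
    · have := hL q hq
      simp only [writes, List.mem_cons, not_or] at this
      rw [write_of_ne _ _ _ this.1, sem_of_notMem_writes this.2, hsL' q hq]
    · rw [write_of_ne _ _ _ (by omega)]
      rcases Nat.lt_succ_iff_lt_or_eq.1 hij with hlt | rfl
      · exact h₂.trans (hm hlt)
      · exact h s' hI (by simpa [hj] using hsL')

/-- Before `improveSt`, `guessSt` leaves the indicator of the assignment in bank `5`. -/
theorem guessSt_sem (h : Incumbent G X s) : ∃ s', guessSt.sem s = improveSt.sem s' ∧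
    Incumbent G X s' ∧ s' 4 0 = s 4 0 ∧
    ∀ v : Fin n, s' 5 v = if greedySt.sem s 11 v = 2 then 1 else 0 := by
  classical
  have hmem : ∀ j, j ∈ greedySt.writes → 10 ≤ j := by
    simp [greedySt, propagateSt, adoptSt, writes]
  have hlow : ∀ j < 10, greedySt.sem s j = s j := fun j hj =>
    sem_of_notMem_writes (fun hj' => by have := hmem j hj'; omega) s
  have h₁ : Incumbent G X (greedySt.sem s) := h.congr fun j hj => hlow j (by omega)
  refine ⟨(St.fill 5 43 (eq (cell 11 43) (.const 2))).sem (greedySt.sem s), rfl,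
    h₁.congr fun j hj => sem_fill_of_ne _ _ _ (by omega), ?_, fun v => ?_⟩
  · rw [sem_fill_of_ne _ _ _ (by omega), hlow 4 (by omega)]
  · rw [sem_fill_same _ _ _ h₁.input.size, eq, Tm.not, eval_ite]
    have := holds_eq (cell 11 43) (.const 2) (write (greedySt.sem s) 43 0 v)
    rw [eq, holds_not, eval_cell, write_reg_self, write_of_ne _ _ _ (by omega), eval_const] at this
    simp only [← this, eval_const]
    split_ifs <;> rfl

theorem improves_guessSt : Improves G X guessSt := by
  intro s hs
  obtain ⟨s', he, hI, h4, h5⟩ := guessSt_sem hs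
  obtain ⟨h₁, h₂, -⟩ := improveSt_spec hI fun v => by rw [h5]; split_ifs <;> omega
  rw [he]
  exact ⟨h₁, h₂.trans h4.le⟩

/-- With the right guess for a halfspace `H`, the candidate is a halfspace and not worse
than `H`. -/
theorem reaches_guessSt {H : Set (Fin n)} (hH : CliqueBorders G H) (hab : G.Adj a b) (ha : a ∈ H)
    (hb : b ∉ H) (hk : CutEdge.Counts G a b k l H) :
    Reaches G X guessSt [(23, l), (22, k), (21, b), (20, a)] (errors X H) := by
  intro s hs hL
  simp only [List.forall_mem_cons, List.not_mem_nil, IsEmpty.forall_iff, implies_true,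
    and_true] at hL
  obtain ⟨s', he, hI, h4, h5⟩ := guessSt_sem hs
  obtain ⟨-, -, h₁⟩ := improveSt_spec hI fun v => by rw [h5]; split_ifs <;> omega
  obtain ⟨F, hF, herr, hmem⟩ := greedySt_spec (X := X) hs.input
    ⟨hL.2.2.2, hL.2.2.1, hL.2.1, hL.1⟩ (CutEdge.feasible_of_cliqueBorders hH hab ha hb hk)
  have hset : setIn n s' 5 = F := by
    ext v
    rw [← hmem v, setIn, Set.mem_ofPred_eq, h5]
    simp
  rw [he]
  rw [hset] at h₁
  exact (h₁ (CutEdge.cliqueBorders_of_feasible hH hab ha hb hk hF)).trans herr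

theorem improves_searchSt : Improves G X searchSt :=
  (((improves_guessSt.loop (by omega)).loop (by omega)).loop (by omega)).loop (by omega)

theorem searchSt_le {H : Set (Fin n)} (hH : CliqueBorders G H) (hab : G.Adj a b) (ha : a ∈ H)
    (hb : b ∉ H) (hs : Incumbent G X s) : searchSt.sem s 4 0 ≤ errors X H := by
  have hlt : ∀ A : Set (Fin n), a ∉ A → A.ncard < n := fun A hA => by
    have := Set.ncard_lt_card (s := A) (fun h => hA (h ▸ Set.mem_univ a))
    simpa using this
  have h₁ := reaches_guessSt (X := X) hH hab ha hb ⟨rfl, rfl⟩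
  have i₁ := improves_guessSt (G := G) (X := X)
  have i₂ := i₁.loop (v := 23) (by omega)
  have i₃ := i₂.loop (v := 22) (by omega)
  have i₄ := i₃.loop (v := 21) (by omega)
  have h₂ := h₁.loop (v := 23) i₁ (by omega) (hlt _ fun h => h.1.1.ne rfl) (by
    simp [guessSt, greedySt, propagateSt, adoptSt, improveSt, writes])
  have h₃ := h₂.loop (v := 22) i₂ (by omega) (hlt _ fun h => h.1.1.ne rfl) (by
    simp [guessSt, greedySt, propagateSt, adoptSt, improveSt, writes])
  have h₄ := h₃.loop (v := 21) i₃ (by omega) b.isLt (by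
    simp [guessSt, greedySt, propagateSt, adoptSt, improveSt, writes])
  exact h₄.loop (v := 20) i₄ (by omega) a.isLt (by simp) s hs (by simp)

theorem ermSt_spec (hG : G.Connected) (h : HasInput G X s) :
    Incumbent G X (ermSt.sem s) ∧
      ∀ H : Set (Fin n), CliqueBorders G H → ermSt.sem s 4 0 ≤ errors X H := by
  set s₁ := write s 4 0 (n + 1) with hs₁
  have h₁ : HasInput G X s₁ := h.write (by omega) _ _
  set s₂ := (St.fill 5 43 (.const 0)).sem s₁ with hs₂
  have h₂ : HasInput G X s₂ := h₁.congr fun j hj => sem_fill_of_ne _ _ _ (by omega)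
  have h₂5 : ∀ v : Fin n, s₂ 5 v = 0 := fun v => by rw [hs₂, sem_fill_same _ _ _ h₁.size, eval_const]
  have h₂set : setIn n s₂ 5 = ∅ := by ext v; simp [setIn, h₂5]
  obtain ⟨h₃, he₃⟩ := improveSt_of_better h₂ (fun v => by rw [h₂5]; omega)
    (by rw [h₂set]; exact fun a _ _ _ _ _ ha => ha.elim) (by
      have := errors_le X (setIn n s₂ 5)
      rw [Fintype.card_fin] at this
      rw [hs₂, sem_fill_of_ne _ _ _ (by omega), ← hs₂, hs₁, write_reg_self]
      omega)
  set s₃ := improveSt.sem s₂ with hs₃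
  set s₄ := (St.fill 5 43 (.const 1)).sem s₃ with hs₄
  have h₄ : Incumbent G X s₄ := h₃.congr fun j hj => sem_fill_of_ne _ _ _ (by omega)
  have h₄4 : s₄ 4 0 = s₃ 4 0 := by rw [hs₄, sem_fill_of_ne _ _ _ (by omega)]
  have h₄5 : ∀ v : Fin n, s₄ 5 v = 1 := fun v => by
    rw [hs₄, sem_fill_same _ _ _ h₃.input.size, eval_const]
  have h₄set : setIn n s₄ 5 = Set.univ := by ext v; simp [setIn, h₄5]
  obtain ⟨h₅, hle₅, herr₅⟩ := improveSt_spec h₄ fun v => (h₄5 v).le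
  have hsem : ermSt.sem s = searchSt.sem (improveSt.sem s₄) := by
    have : (St.set 4 (.add (var 0) (.const 1))).sem s = s₁ := by
      simp [sem, eval, h.size, hs₁]
    rw [ermSt, sem, this]
    rfl
  rw [hsem]
  obtain ⟨h₆, hle₆⟩ := improves_searchSt _ h₅
  refine ⟨h₆, fun H hH => ?_⟩
  by_cases hcut : ∃ a b, G.Adj a b ∧ a ∈ H ∧ b ∉ H
  · obtain ⟨a, b, hab, ha, hb⟩ := hcut
    exact searchSt_le hH hab ha hb h₅
  · -- a set without cut edges is empty or contains all vertices
    refine hle₆.trans ?_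
    rcases H.eq_empty_or_nonempty with rfl | ⟨u, hu⟩
    · rw [h₂set] at he₃
      exact hle₅.trans (h₄4.trans he₃).le
    · have huniv : H = Set.univ := by
        refine Set.eq_univ_of_forall fun v => ?_
        by_contra hv
        obtain ⟨p⟩ := hG.preconnected u v
        obtain ⟨d, -, h₁, h₂⟩ := p.exists_boundary_dart H hu hv
        exact hcut ⟨d.fst, d.snd, d.adj, h₁, h₂⟩
      rw [huniv, ← h₄set]
      exact herr₅ (h₄set ▸ huniv ▸ hH)

end RAM

theorem mainTheorem8 :
    ∃ (P : RAM.Program) (T : Polynomial ℕ),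
      ∀ (n : ℕ) (G : SimpleGraph (Fin n)) (X : Fin n → SignType), G.Connected →
        ∃ (t : ℕ) (s : RAM.Memory) (H : Set (Fin n)),
          RAM.Runs P (RAM.inputMemory G X) t s ∧ t ≤ T.eval n ∧
            RAM.Outputs s H ∧ IsERM G X H := by
  refine ⟨RAM.ermSt.compile 100, RAM.ermSt.cost, fun n G X hG => ?_⟩
  obtain ⟨t, s, hrun, ht, hs⟩ := RAM.St.steps_compile (by omega) RAM.ermSt_ok
    (s := RAM.inputMemory G X) fun _ _ => rfl
  obtain ⟨hI, hmin⟩ := RAM.ermSt_spec hG (RAM.hasInput_inputMemory (G := G) (X := X))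
  have hI' : RAM.Incumbent G X s := hI.congr fun k hk => hs k (by omega)
  refine ⟨t, s, RAM.setIn n s 3, hrun, ht, fun v => ?_,
    (isMHalfspace_iff_cliqueBorders hG).2 hI'.borders, fun H hH => ?_⟩
  · have := hI'.le_one v
    simp only [RAM.setIn, Set.mem_ofPred_eq]
    by_cases h : s 3 v = 0
    · simp [h]
    · simp only [ne_eq, h, not_false_eq_true, if_true]
      omega
  · refine empiricalRisk_le X ?_
    rw [hI'.errors_eq, hs 4 (by omega)]
    exact hmin H ((isMHalfspace_iff_cliqueBorders hG).1 hH)
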